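/- Let $k$ be a positive integer. A $k$-precolouring of a finite simple graph $G=(V,E)$ is a function $c_W\colon W\to\{1,\dots,k\}$ defined on some subset $W\subseteq V$ (it need not be proper); a proper $k$-colouring $c\colon V\to\{1,\dots,k\}$ of $G$ extends $c_W$ if $c(v)=c_W(v)$ for all $v\in W$. The problem $k$-Precolouring Extension asks, given a graph $G$ and a $k$-precolouring $c_W$ of $G$, whether $G$ has a proper $k$-colouring that extends $c_W$ (here $k$ is fixed and not part of the input). Then $k$-Precolouring Extension is polynomial-time solvable for graphs of maximum degree at most $k$: there are a deterministic Turing machine and a polynomial $p$ such that, on every input $(G,c_W)$ in which $G$ has maximum degree at most $k$, given by the adjacency matrix of $G$ and the partial list of colours $c_W$, the machine decides correctly whether $c_W$ extends to a proper $k$-colouring of $G$ and halts after at most $p(N)$ steps, where $N$ is the length of the input. -/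

import Mathlib

open scoped Classical in
/-- Polynomial-time solvability of a decision problem restricted to a class of inputs: instances of
type `α` are written as words over the alphabet `Γ` by `enc`, the admissible inputs are those in
`S`, and the question is whether `P` holds. There has to be one (multi-stack) Turing machine and one
polynomial `p` such that on every admissible input `a` the machine halts after at most
`p (length of enc a)` steps with output the truth value of `P a`. The structure
`Turing.TM2ComputableInPolyTime` forces `Γ` to be finite. -/
def PolyTimeSolvableOn {α Γ : Type} (enc : α → List Γ) (S : Set α) (P : α → Prop) : Prop :=
  Nonempty (Turing.TM2ComputableInPolyTime
    (fun a : S => enc a) Computability.encodeBool (fun a : S => decide (P a)))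

/-- An instance of `k`-Precolouring Extension: a finite simple graph, with vertices numbered
`0, …, n - 1`, together with a `k`-precolouring, that is, a function from a subset `W` of the vertex
set to the `k` colours, here a partial function that is `none` exactly outside `W`.
A precolouring is not required to be proper. -/
structure PrecolouringInstance (k : ℕ) where
  /-- number of vertices -/
  n : ℕ
  /-- the graph -/
  graph : SimpleGraph (Fin n)
  /-- the precolouring -/
  precolour : Fin n → Option (Fin k)

namespace PrecolouringInstance

variable {k : ℕ}

/-- The question of `k`-Precolouring Extension: is there a (proper) `k`-colouring of the graph that
agrees with the precolouring on its domain? -/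
def HasExtension (I : PrecolouringInstance k) : Prop :=
  ∃ c : I.graph.Coloring (Fin k), ∀ v a, I.precolour v = some a → c v = a

open scoped Classical in
/-- The instances whose graph has maximum degree at most `d`. -/
def maxDegreeAtMost (k d : ℕ) : Set (PrecolouringInstance k) :=
  {I | I.graph.maxDegree ≤ d}

open scoped Classical in
/-- The part of the input word that describes vertex `v`: its colour under the precolouring (or
`none`), followed by its row of the adjacency matrix. -/
noncomputable def encodeVertex (I : PrecolouringInstance k) (v : Fin I.n) :
    List (Option (Fin k) ⊕ Bool) :=
  Sum.inl (I.precolour v) ::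
    (List.finRange I.n).map fun w => Sum.inr (decide (I.graph.Adj v w))

/-- The input word of an instance: the adjacency matrix, row by row, each row preceded by the colour
of its vertex under the precolouring. It has length `n * (n + 1)`. -/
noncomputable def encode (I : PrecolouringInstance k) : List (Option (Fin k) ⊕ Bool) :=
  (List.finRange I.n).flatMap I.encodeVertex

/-- The input word determines the instance. -/
theorem encode_injective :
    Function.Injective (encode : PrecolouringInstance k → List (Option (Fin k) ⊕ Bool)) := by
  rintro ⟨n, G, c⟩ ⟨n', G', c'⟩ h
  have hlen : ∀ I : PrecolouringInstance k, I.encode.length = I.n * (I.n + 1) := by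
    intro I
    simp [encode, encodeVertex, List.length_flatMap]
  have hn : n = n' := by
    have h1 := hlen ⟨n, G, c⟩
    rw [h, hlen] at h1
    simp only at h1
    nlinarith
  subst hn
  simp only [encode, List.flatMap_def] at h
  have h2 := (List.eq_iff_flatten_eq).2 ⟨h, by simp [encodeVertex, Function.comp_def]⟩
  have h3 : ∀ v, encodeVertex ⟨n, G, c⟩ v = encodeVertex ⟨n, G', c'⟩ v := by
    simpa using h2
  have hc : c = c' := by
    funext v
    have := h3 v
    simp only [encodeVertex, List.cons.injEq, Sum.inl.injEq] at this
    exact this.1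
  have hG : G = G' := by
    ext v w
    have := h3 v
    simp only [encodeVertex, List.cons.injEq] at this
    have hw := List.map_inj_left.1 this.2 w (List.mem_finRange w)
    simpa using hw
  rw [hc, hG]

end PrecolouringInstance

/-! Deleting the precoloured vertices leaves a list colouring problem. An uncoloured vertex loses at
most one colour per precoloured neighbour, so, the degrees being at most k, its list is at least as
long as its degree among the uncoloured vertices. A connected graph with such lists is uncolourable
only for a rigid reason, as in the theory of Gallai trees: its blocks are cliques or are coloured
from at most two colours. The algorithm does not search for this structure. It enforces local
consistency, which is shown to refute every such obstruction.

For each pair of vertices the algorithm keeps a set of pairs of colours, and it discards those that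
violate a constraint or do not extend to a solution on some tuple of k + 2 vertices. No solution is
ever lost, so an empty relation means that there is no extension. Conversely, suppose that the
relations are consistent and nonempty, but that the remaining list problem has an uncolourable
connected part. By `disjoint_of_not_colourable` the colours still allowed at a vertex of that part
avoid its list. They also lie in the list, so there are none, a contradiction; this is
`hasExtension_of_isConsistent`.

The proof of `disjoint_of_not_colourable` is an induction on the vertex set. Without a cut vertex
all lists agree (`list_eq_of_no_cut`), and with three or more colours the graph is complete
(`isClique_of_no_cut`). Cliques are refuted by the pigeonhole principle inside one tuple
(`IsConsistent.clique_rule`), lists of at most two colours by propagation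
(`IsConsistent.pair_rule`). At a cut vertex the list is covered by the colours blocked on either
side, and each side is a smaller instance.

For the running time, the algorithm is written as an array program whose loops run over row indices.
Such programs compile to stack machines with a polynomial time bound (`runsTo_compile`,
`polyTime_of_cmd`). As k is fixed, there are polynomially many tuples, each treated in constant
time. At most n²k² pairs can be discarded, so polynomially many passes suffice (`exec_closeCmd`). -/

namespace ListColouring

set_option linter.unusedSectionVars false

open Finset

/-! ### List colouring with lists at least as long as the degrees -/

variable {V α : Type*} [DecidableEq V] [DecidableEq α] (G : SimpleGraph V) [DecidableRel G.Adj]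

/-- The number of neighbours of `v` in `S`. -/
def degOn (S : Finset V) (v : V) : ℕ := (S.filter (G.Adj v)).card

/-- The subgraph induced by `S` is (pre)connected: every proper nonempty part of `S` is joined by
an edge to the rest of `S`. -/
def ConnOn (S : Finset V) : Prop :=
  ∀ T ⊆ S, T.Nonempty → (S \ T).Nonempty → ∃ u ∈ T, ∃ v ∈ S \ T, G.Adj u v

/-- The subgraph induced by `S` has a proper colouring from the lists `L`. -/
def Colourable (S : Finset V) (L : V → Finset α) : Prop :=
  ∃ c : V → α, (∀ v ∈ S, c v ∈ L v) ∧ ∀ u ∈ S, ∀ v ∈ S, G.Adj u v → c u ≠ c v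

/-- The lists after `v` has received the colour `c`. -/
def prune (L : V → Finset α) (v : V) (c : α) : V → Finset α :=
  fun w => if G.Adj v w then (L w).erase c else L w

variable {G}

theorem degOn_mono {S T : Finset V} (h : T ⊆ S) (v : V) : degOn G T v ≤ degOn G S v :=
  card_le_card (filter_subset_filter _ h)

theorem degOn_lt {S T : Finset V} (h : T ⊆ S) {v w : V} (hw : w ∈ S) (hwT : w ∉ T)
    (ha : G.Adj v w) : degOn G T v < degOn G S v := by
  refine card_lt_card ⟨filter_subset_filter _ h, fun h' => hwT ?_⟩
  exact (mem_filter.1 (h' (mem_filter.2 ⟨hw, ha⟩))).1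

theorem degOn_erase_add_one {S : Finset V} {v w : V} (hv : v ∈ S) (ha : G.Adj w v) :
    degOn G (S.erase v) w + 1 = degOn G S w := by
  unfold degOn
  rw [filter_erase, card_erase_add_one (mem_filter.2 ⟨hv, ha⟩)]

/-- A colouring of `S` without `v` from the pruned lists extends to `S`. -/
theorem Colourable.of_prune {S : Finset V} {L : V → Finset α} {v : V} {c : α} (hc : c ∈ L v)
    (h : Colourable G (S.erase v) (prune G L v c)) : Colourable G S L := by
  obtain ⟨f, h1, h2⟩ := h
  have key : ∀ u ∈ S, u ≠ v → G.Adj v u → f u ≠ c := by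
    intro u hu huv ha
    have := h1 u (mem_erase.2 ⟨huv, hu⟩)
    rw [prune, if_pos ha] at this
    exact (mem_erase.1 this).1
  refine ⟨Function.update f v c, fun u hu => ?_, fun u hu w hw ha => ?_⟩
  · by_cases huv : u = v
    · subst huv; simpa using hc
    · have := h1 u (mem_erase.2 ⟨huv, hu⟩)
      rw [Function.update_of_ne huv]
      unfold prune at this
      split_ifs at this
      · exact (mem_erase.1 this).2
      · exact this
  · by_cases huv : u = v
    · subst huv
      have hwu : w ≠ u := ha.ne'
      rw [Function.update_self, Function.update_of_ne hwu]
      exact (key w hw hwu ha).symm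
    · by_cases hwv : w = v
      · subst hwv
        rw [Function.update_self, Function.update_of_ne huv]
        exact key u hu huv ha.symm
      · rw [Function.update_of_ne huv, Function.update_of_ne hwv]
        exact h2 u (mem_erase.2 ⟨huv, hu⟩) w (mem_erase.2 ⟨hwv, hw⟩) ha

/-- Greedy colouring along a degeneracy order. -/
theorem colourable_of_degenerate [Nonempty α] (L : V → Finset α) (S : Finset V)
    (h : ∀ T ⊆ S, T.Nonempty → ∃ v ∈ T, degOn G T v < (L v).card) : Colourable G S L := by
  induction hn : S.card generalizing S with
  | zero =>
    rw [card_eq_zero] at hn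
    subst hn
    exact ⟨fun _ => Classical.arbitrary α, by simp, by simp⟩
  | succ n ih =>
    obtain ⟨v, hv, hlt⟩ := h S Subset.rfl (card_pos.1 (by omega))
    obtain ⟨f, h1, h2⟩ := ih (S.erase v) (fun T hT => h T (hT.trans (erase_subset _ _)))
      (by rw [card_erase_of_mem hv, hn]; rfl)
    obtain ⟨c, hc, hc'⟩ : ∃ c ∈ L v, c ∉ (S.filter (G.Adj v)).image f := by
      by_contra! hcon
      exact absurd ((card_le_card hcon).trans card_image_le) (not_le.2 hlt)
    refine Colourable.of_prune hc ⟨f, fun w hw => ?_, h2⟩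
    unfold prune
    split_ifs with ha
    · refine mem_erase.2 ⟨fun hw' => hc' ?_, h1 w hw⟩
      exact mem_image.2 ⟨w, mem_filter.2 ⟨mem_of_mem_erase hw, ha⟩, hw'⟩
    · exact h1 w hw

/-- A connected graph with lists at least as long as the degrees is colourable as soon as one list
is longer than the degree. -/
theorem ConnOn.colourable_of_lt [Nonempty α] {S : Finset V} (hS : ConnOn G S) {L : V → Finset α}
    (hL : ∀ v ∈ S, degOn G S v ≤ (L v).card) {v : V} (hv : v ∈ S)
    (hlt : degOn G S v < (L v).card) : Colourable G S L := by
  refine colourable_of_degenerate L S fun T hT hne => ?_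
  by_cases h : (S \ T).Nonempty
  · obtain ⟨u, hu, w, hw, ha⟩ := hS T hT hne h
    rw [mem_sdiff] at hw
    exact ⟨u, hu, (degOn_lt hT hw.1 hw.2 ha).trans_le (hL u (hT hu))⟩
  · have : T = S := hT.antisymm (sdiff_eq_empty_iff_subset.1 (not_nonempty_iff_eq_empty.1 h))
    subst this
    exact ⟨v, hv, hlt⟩

theorem ConnOn.card_eq_degOn [Nonempty α] {S : Finset V} (hS : ConnOn G S) {L : V → Finset α}
    (hL : ∀ v ∈ S, degOn G S v ≤ (L v).card) (hc : ¬ Colourable G S L) {v : V} (hv : v ∈ S) :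
    (L v).card = degOn G S v :=
  le_antisymm (not_lt.1 fun h => hc (hS.colourable_of_lt hL hv h)) (hL v hv)

/-- A neighbour of v loses one neighbour and at most one colour; all other lists are untouched. So
the standing hypothesis on the lists survives giving v a colour. -/
theorem degOn_erase_le_card_prune {S : Finset V} {L : V → Finset α}
    (hL : ∀ v ∈ S, degOn G S v ≤ (L v).card) {v : V} (hv : v ∈ S) (c : α) :
    ∀ w ∈ S.erase v, degOn G (S.erase v) w ≤ (prune G L v c w).card := by
  intro w hw
  have h := hL w (mem_of_mem_erase hw)
  unfold prune
  split_ifs with ha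
  · have h1 := degOn_erase_add_one hv ha.symm
    have h2 := pred_card_le_card_erase (s := L w) (a := c)
    omega
  · exact (degOn_mono (erase_subset _ _) w).trans h

/-- In an uncolourable connected graph, the list of a vertex that is not a cut vertex is contained
in the lists of its neighbours. -/
theorem list_subset_of_adj [Nonempty α] {S : Finset V} {L : V → Finset α}
    (hL : ∀ v ∈ S, degOn G S v ≤ (L v).card) (hc : ¬ Colourable G S L) {u v : V} (hu : u ∈ S)
    (hv : v ∈ S) (ha : G.Adj v u) (hconn : ConnOn G (S.erase v)) : L v ⊆ L u := by
  intro c hcv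
  by_contra hcu
  -- Giving v the colour c costs u a neighbour but no colour, so u gains slack.
  refine hc (Colourable.of_prune hcv ?_)
  have hu' : u ∈ S.erase v := mem_erase.2 ⟨ha.ne', hu⟩
  refine hconn.colourable_of_lt (degOn_erase_le_card_prune hL hv c) hu' ?_
  rw [prune, if_pos ha, erase_eq_of_notMem hcu]
  have := degOn_erase_add_one hv ha.symm
  have := hL u hu
  omega

/-- In an uncolourable connected graph without cut vertices all lists agree. -/
theorem list_eq_of_no_cut [Nonempty α] {S : Finset V} {L : V → Finset α} (hS : ConnOn G S)
    (hL : ∀ v ∈ S, degOn G S v ≤ (L v).card) (hc : ¬ Colourable G S L)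
    (hcut : ∀ v ∈ S, ConnOn G (S.erase v)) {u v : V} (hu : u ∈ S) (hv : v ∈ S) : L u = L v := by
  by_contra hne
  -- If some list differed, an edge would join the class of vertices with the list of u to its
  -- complement; the inclusions in both directions along that edge are contradictory.
  obtain ⟨x, hx, y, hy, ha⟩ := hS (S.filter (L · = L u)) (filter_subset _ _)
    ⟨u, by simp [hu]⟩ ⟨v, by simp [hv, Ne.symm hne]⟩
  simp only [mem_filter, mem_sdiff, not_and] at hx hy
  apply hy.2 hy.1
  rw [← hx.2]
  exact (list_subset_of_adj hL hc hx.1 hy.1 ha.symm (hcut y hy.1)).antisymm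
    (list_subset_of_adj hL hc hy.1 hx.1 ha (hcut x hx.1))

/-! ### Separating pairs in graphs without cut vertices -/

/-- `D` is a nonempty part of `S` that the two vertices `a` and `b` separate from a nonempty rest
of `S`. -/
def IsFragment (G : SimpleGraph V) (S D : Finset V) (a b : V) : Prop :=
  a ∈ S ∧ b ∈ S ∧ a ≠ b ∧ D ⊆ S ∧ a ∉ D ∧ b ∉ D ∧ D.Nonempty ∧
    (∃ e ∈ S, e ∉ D ∧ e ≠ a ∧ e ≠ b) ∧
    ∀ u ∈ D, ∀ w ∈ S, G.Adj u w → w ∈ D ∨ w = a ∨ w = b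

theorem IsFragment.symm {S D : Finset V} {a b : V} (h : IsFragment G S D a b) :
    IsFragment G S D b a := by
  obtain ⟨h1, h2, h3, h4, h5, h6, h7, ⟨e, he⟩, h9⟩ := h
  exact ⟨h2, h1, h3.symm, h4, h6, h5, h7, ⟨e, by tauto⟩, fun u hu w hw ha => by
    have := h9 u hu w hw ha; tauto⟩

theorem IsFragment.compl {S D : Finset V} {a b : V} (h : IsFragment G S D a b) :
    IsFragment G S ((S \ D) \ {a, b}) a b := by
  obtain ⟨h1, h2, h3, h4, h5, h6, ⟨d, hd⟩, ⟨e, he, he1, he2, he3⟩, h9⟩ := h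
  refine ⟨h1, h2, h3, sdiff_subset.trans sdiff_subset, by simp, by simp, ⟨e, by simp_all⟩,
    ⟨d, h4 hd, by simp [hd], by rintro rfl; exact h5 hd, by rintro rfl; exact h6 hd⟩, ?_⟩
  intro u hu w hw ha
  simp only [mem_sdiff, mem_insert, mem_singleton, not_or] at hu ⊢
  by_contra hcon
  have hwD : w ∈ D := by tauto
  have := h9 w hwD u hu.1.1 ha.symm
  tauto

theorem exists_adj_out_of_no_cut {S : Finset V} (hcut : ∀ v ∈ S, ConnOn G (S.erase v))
    {X : Finset V} {y e : V} (hy : y ∈ S) (hX : X ⊆ S) (hyX : y ∉ X) (hne : X.Nonempty)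
    (he : e ∈ S) (heX : e ∉ X) (hey : e ≠ y) : ∃ u ∈ X, ∃ w ∈ S, w ∉ X ∧ w ≠ y ∧ G.Adj u w := by
  obtain ⟨u, hu, w, hw, ha⟩ := hcut y hy X
    (fun x hx => mem_erase.2 ⟨by rintro rfl; exact hyX hx, hX hx⟩) hne
    ⟨e, by simp_all⟩
  simp only [mem_sdiff, mem_erase] at hw
  exact ⟨u, hu, w, hw.1.2, hw.2, hw.1.1, ha⟩

/-- If T left D, then, z not being a cut vertex, an edge would lead from T \ D to a vertex outside
it other than z. That vertex is in T ∩ D or is v, hence in D. But D is left only through a and b,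
which T avoids. -/
theorem IsFragment.ssubset_of_notMem {S : Finset V}
    (hcut : ∀ v ∈ S, ConnOn G (S.erase v)) {D T : Finset V} {a b v z : V}
    (hD : IsFragment G S D a b) (hv : v ∈ D) (hT : IsFragment G S T v z)
    (haT : a ∉ T) (hbT : b ∉ T) : T ⊂ D := by
  obtain ⟨-, -, -, hDS, haD, hbD, -, -, hDout⟩ := hD
  obtain ⟨hvS, hzS, hvz, hTS, hvT, hzT, -, -, hTout⟩ := hT
  refine ⟨fun t ht => ?_, fun h => hvT (h hv)⟩
  by_contra htD
  obtain ⟨u, hu, w, hw, hwX, hwz, ha⟩ := exists_adj_out_of_no_cut hcut hzS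
    (X := T \ D) (e := v) (sdiff_subset.trans hTS) (by simp [hzT]) ⟨t, by simp [ht, htD]⟩ hvS
    (by simp [hvT]) hvz
  simp only [mem_sdiff, not_and, not_not] at hu hwX
  have h1 := hTout u hu.1 w hw ha
  have hwD : w ∈ D := by
    rcases h1 with h | h | h
    · exact hwX h
    · exact h ▸ hv
    · exact absurd h hwz
  rcases hDout w hwD u (hTS hu.1) ha.symm with h | h | h
  · exact hu.2 h
  · exact haT (h ▸ hu.1)
  · exact hbT (h ▸ hu.1)

/-- Otherwise, a not being a cut vertex, an edge leaves T \ D without a and does not end in a. As v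
and z are both in D, so is its far end. Its near end is then a or b, but a was removed and b is not
in T. -/
theorem IsFragment.eq_of_mem_of_notMem {S : Finset V}
    (hcut : ∀ v ∈ S, ConnOn G (S.erase v)) {D T : Finset V} {a b v z e : V}
    (hD : IsFragment G S D a b) (hv : v ∈ D) (hT : IsFragment G S T v z)
    (hbT : b ∉ T) (hzD : z ∈ D) (heT : e ∈ T) (heD : e ∉ D) : e = a := by
  obtain ⟨haS, hbS, hab, hDS, haD, hbD, -, -, hDout⟩ := hD
  obtain ⟨hvS, hzS, hvz, hTS, hvT, hzT, -, -, hTout⟩ := hT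
  by_contra hea
  obtain ⟨u, hu, w, hw, hwX, hwa, ha⟩ := exists_adj_out_of_no_cut hcut haS
    (X := (T \ D).erase a) (e := b) ((erase_subset _ _).trans (sdiff_subset.trans hTS))
    (by simp) ⟨e, by simp [heT, heD, hea]⟩ hbS (by simp [hbT]) hab.symm
  simp only [mem_sdiff, mem_erase] at hu hwX
  have h1 := hTout u hu.2.1 w hw ha
  have hwD : w ∈ D := by
    rcases h1 with h | h | h
    · by_contra hh; exact hwX ⟨hwa, h, hh⟩
    · exact h ▸ hv
    · exact h ▸ hzD
  rcases hDout w hwD u (hTS hu.2.1) ha.symm with h | h | h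
  · exact absurd h hu.2.2
  · exact absurd h hu.1
  · exact absurd (h ▸ hu.2.1) hbT

/-- An edge leaving T ∩ D ends in the boundary of T or of D. The end b is impossible, as b is
neither in T nor z, and z is not in D, so it can be an end only if it is a. The vertex b witnesses
that the rest is nonempty. -/
theorem IsFragment.inter {S D T : Finset V} {a b v z : V}
    (hD : IsFragment G S D a b) (hv : v ∈ D) (hT : IsFragment G S T v z)
    (hbT : b ∉ T) (hbz : b ≠ z) (hzD : z ∉ D) (hne : (T ∩ D).Nonempty) :
    IsFragment G S (T ∩ D) v a := by
  obtain ⟨haS, hbS, hab, hDS, haD, hbD, -, -, hDout⟩ := hD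
  obtain ⟨hvS, hzS, hvz, hTS, hvT, hzT, -, -, hTout⟩ := hT
  refine ⟨hvS, haS, fun h => haD (h ▸ hv), inter_subset_left.trans hTS, by simp [hvT],
    by simp [haD], hne, ⟨b, hbS, by simp [hbT], fun h => hbD (h ▸ hv), hab.symm⟩, ?_⟩
  intro u hu w hw ha
  rw [mem_inter] at hu ⊢
  rcases hTout u hu.1 w hw ha with h | h | h
  · rcases hDout u hu.2 w hw ha with h' | h' | h'
    · exact Or.inl ⟨h, h'⟩
    · exact Or.inr (Or.inr h')
    · exact absurd (h' ▸ h) hbT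
  · exact Or.inr (Or.inl h)
  · rcases hDout u hu.2 w hw ha with h' | h' | h'
    · exact absurd (h ▸ h') hzD
    · exact Or.inr (Or.inr h')
    · exact absurd (h'.symm.trans h) hbz

/-- Here the pair v, z separates a from b, and the two sides of that pair play symmetric roles. If z
were in D, a third vertex outside D would lie on one of the sides and be forced to equal a or b. So
z is outside D, and any vertex of D other than v lies on one side, whose intersection with D is a
fragment without v. -/
theorem IsFragment.exists_ssubset_of_mem {S : Finset V}
    (hcut : ∀ v ∈ S, ConnOn G (S.erase v)) {D T : Finset V} {a b v z : V}
    (hD : IsFragment G S D a b) (hv : v ∈ D) (hDcard : D ≠ {v}) (hT : IsFragment G S T v z)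
    (haT : a ∈ T) (hbT : b ∉ T) (hbz : b ≠ z) :
    ∃ D' a' b', D' ⊂ D ∧ IsFragment G S D' a' b' := by
  have hT' := hT.compl
  have hvT := hT.2.2.2.2.1
  have hzT := hT.2.2.2.2.2.1
  have haD : a ∉ D := hD.2.2.2.2.1
  have hbD : b ∉ D := hD.2.2.2.2.2.1
  have hbv : b ≠ v := fun h => hbD (h ▸ hv)
  have hbT' : b ∈ (S \ T) \ {v, z} := by simp [hD.2.1, hbT, hbz, hbv]
  have haT' : a ∉ (S \ T) \ {v, z} := by simp [haT]
  by_cases hzD : z ∈ D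
  · obtain ⟨e, heS, heD, hea, heb⟩ := hD.2.2.2.2.2.2.2.1
    by_cases heT : e ∈ T
    · exact absurd (hD.eq_of_mem_of_notMem hcut hv hT hbT hzD heT heD) hea
    · refine absurd (hD.symm.eq_of_mem_of_notMem hcut hv hT' haT' hzD ?_ heD) heb
      have h1 : e ≠ v := fun h => heD (h ▸ hv)
      have h2 : e ≠ z := fun h => heD (h ▸ hzD)
      simp [heS, heT, h1, h2]
  · have hss : ∀ X : Finset V, v ∉ X → X ∩ D ⊂ D := fun X hX =>
      ⟨inter_subset_right, fun h => hX (mem_inter.1 (h hv)).1⟩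
    by_cases h1 : (T ∩ D).Nonempty
    · exact ⟨_, _, _, hss T hvT, hD.inter hv hT hbT hbz hzD h1⟩
    · have haz : a ≠ z := fun h => hzT (h ▸ haT)
      refine ⟨_, _, _, hss _ (by simp), hD.symm.inter hv hT' haT' haz hzD ?_⟩
      obtain ⟨w, hw, hwv⟩ : ∃ w ∈ D, w ≠ v := by
        by_contra! h
        exact hDcard (eq_singleton_iff_unique_mem.2 ⟨hv, h⟩)
      have hwT : w ∉ T := fun h => h1 ⟨w, mem_inter.2 ⟨h, hw⟩⟩
      have hwz : w ≠ z := fun h => hzD (h ▸ hw)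
      exact ⟨w, by simp [hw, hwT, hwz, hwv, hD.2.2.2.1 hw]⟩

/-- If there is no cut vertex and every vertex that is not joined to all others belongs to a
separating pair, then some fragment is a single vertex, provided that there is a fragment. -/
theorem exists_singleton_fragment {S : Finset V}
    (hcut : ∀ v ∈ S, ConnOn G (S.erase v))
    (hsep : ∀ v ∈ S, (∃ w ∈ S, w ≠ v ∧ ¬ G.Adj v w) → ∃ z T, IsFragment G S T v z)
    (D : Finset V) : ∀ a b : V, IsFragment G S D a b → ∃ v a b, IsFragment G S {v} a b := by
  induction D using Finset.strongInduction with
  | H D ih =>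
    intro a b hD
    obtain ⟨v, hv⟩ := hD.2.2.2.2.2.2.1
    by_cases hDv : D = {v}
    · exact ⟨v, a, b, hDv ▸ hD⟩
    obtain ⟨e, heS, heD, hea, heb⟩ := hD.2.2.2.2.2.2.2.1
    obtain ⟨z, T, hT⟩ := hsep v (hD.2.2.2.1 hv) ⟨e, heS, fun h => heD (h ▸ hv), fun h => by
      rcases hD.2.2.2.2.2.2.2.2 v hv e heS h with h | h | h <;> contradiction⟩
    have haD : a ∉ D := hD.2.2.2.2.1
    have hbD : b ∉ D := hD.2.2.2.2.2.1
    -- If one side of the pair v, z avoids both a and b, that side is a smaller fragment; otherwise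
    -- the pair separates a from b.
    by_cases h1 : a ∉ T ∧ b ∉ T
    · exact ih T (hD.ssubset_of_notMem hcut hv hT h1.1 h1.2) _ _ hT
    by_cases h2 : a ∉ (S \ T) \ {v, z} ∧ b ∉ (S \ T) \ {v, z}
    · exact ih _ (hD.ssubset_of_notMem hcut hv hT.compl h2.1 h2.2) _ _ hT.compl
    simp only [mem_sdiff, mem_insert, mem_singleton] at h2
    have : (a ∈ T ∧ b ∉ T ∧ b ≠ z) ∨ (b ∈ T ∧ a ∉ T ∧ a ≠ z) := by tauto
    rcases this with ⟨h3, h4, h5⟩ | ⟨h3, h4, h5⟩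
    · obtain ⟨D', a', b', hss, hD'⟩ := hD.exists_ssubset_of_mem hcut hv hDv hT h3 h4 h5
      exact ih D' hss _ _ hD'
    · obtain ⟨D', a', b', hss, hD'⟩ := hD.symm.exists_ssubset_of_mem hcut hv hDv hT h3 h4 h5
      exact ih D' hss _ _ hD'

theorem isFragment_of_not_connOn {S : Finset V} {a y : V} (ha : a ∈ S) (hy : y ∈ S.erase a)
    (h : ¬ ConnOn G ((S.erase a).erase y)) : ∃ T, IsFragment G S T a y := by
  unfold ConnOn at h
  push Not at h
  obtain ⟨T, hTS, hne, ⟨e, he⟩, hT⟩ := h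
  simp only [mem_erase, mem_sdiff] at he hy hT
  refine ⟨T, ha, hy.2, hy.1.symm, fun t ht => mem_of_mem_erase (mem_of_mem_erase (hTS ht)),
    fun h => by simpa using hTS h, fun h => by simpa using hTS h, hne,
    ⟨e, he.1.2.2, he.2, he.1.2.1, he.1.1⟩, fun u hu w hw hadj => ?_⟩
  by_contra hcon
  push Not at hcon
  exact hT u hu w ⟨⟨hcon.2.2, hcon.2.1, hw⟩, hcon.1⟩ hadj

/-- An uncolourable connected graph without cut vertices is complete if its lists have at least
three colours. -/
theorem isClique_of_no_cut [Nonempty α] {S : Finset V} {L : V → Finset α} (hS : ConnOn G S)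
    (hL : ∀ v ∈ S, degOn G S v ≤ (L v).card) (hc : ¬ Colourable G S L)
    (hcut : ∀ v ∈ S, ConnOn G (S.erase v)) (h3 : ∀ v ∈ S, 3 ≤ (L v).card) :
    G.IsClique S := by
  have hsep : ∀ v ∈ S, (∃ w ∈ S, w ≠ v ∧ ¬ G.Adj v w) → ∃ z T, IsFragment G S T v z := by
    rintro v hv ⟨w, hw, hwv, hvw⟩
    by_contra hno
    obtain ⟨c, hcv⟩ : (L v).Nonempty := card_pos.1 (by have := h3 v hv; omega)
    obtain ⟨u, hu⟩ : (S.filter (G.Adj v)).Nonempty := by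
      rw [← card_pos]
      have := hS.card_eq_degOn hL hc hv
      have := h3 v hv
      unfold degOn at *
      omega
    rw [mem_filter] at hu
    -- As v is in no separating pair, deleting it creates no cut vertex. After v has received c, the
    -- remaining lists must therefore all agree; yet the neighbour u has lost c, while the
    -- non-neighbour w still has it.
    have hEq := list_eq_of_no_cut (hcut v hv) (degOn_erase_le_card_prune hL hv c)
      (fun h => hc (Colourable.of_prune hcv h)) (fun y hy => by
        by_contra hy'
        obtain ⟨T, hT⟩ := isFragment_of_not_connOn hv hy hy'
        exact hno ⟨y, T, hT⟩) (mem_erase.2 ⟨hu.2.ne', hu.1⟩) (mem_erase.2 ⟨hwv, hw⟩)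
    rw [prune, prune, if_pos hu.2, if_neg hvw] at hEq
    have h1 := list_eq_of_no_cut hS hL hc hcut hw hv
    rw [h1] at hEq
    rw [← hEq] at hcv
    simp at hcv
  intro v hv w hw hvw
  by_contra ha
  obtain ⟨z, T, hT⟩ := hsep v hv ⟨w, hw, Ne.symm hvw, ha⟩
  -- The neighbours of a one-vertex fragment lie in its separating pair, so its degree is at most
  -- two, against a list of at least three colours.
  obtain ⟨x, a, b, hx⟩ := exists_singleton_fragment hcut hsep T _ _ hT
  have hxS : x ∈ S := hx.2.2.2.1 (mem_singleton_self x)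
  have h1 := hS.card_eq_degOn hL hc hxS
  have h2 : S.filter (G.Adj x) ⊆ {a, b} := by
    intro w hw
    rw [mem_filter] at hw
    have := hx.2.2.2.2.2.2.2.2 x (mem_singleton_self x) w hw.1 hw.2
    simp only [mem_singleton, mem_insert] at this ⊢
    rcases this with h | h
    · exact absurd h hw.2.ne'
    · exact h
  have h4 := (card_le_card h2).trans card_le_two
  have := h3 x hxS
  unfold degOn at h1
  omega

/-! ### Splitting the list of a cut vertex -/

/-- Gluing along a cut vertex: a part of a connected set together with the cut vertex is
connected. -/
theorem ConnOn.insert_of_cut {S T : Finset V} {y : V} (hS : ConnOn G S) (hTS : T ⊆ S.erase y)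
    (hyS : y ∈ S) (hT : ∀ u ∈ T, ∀ w ∈ S, G.Adj u w → w ∈ T ∨ w = y) :
    ConnOn G (insert y T) := by
  have key : ∀ X ⊆ insert y T, y ∉ X → X.Nonempty →
      ∃ u ∈ X, ∃ w ∈ insert y T \ X, G.Adj u w := by
    intro X hX hyX hne
    have hXT : X ⊆ T := fun x hx => (mem_insert.1 (hX hx)).resolve_left
      (by rintro rfl; exact hyX hx)
    obtain ⟨u, hu, w, hw, ha⟩ := hS X (hXT.trans (hTS.trans (erase_subset _ _))) hne
      ⟨y, mem_sdiff.2 ⟨hyS, hyX⟩⟩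
    rw [mem_sdiff] at hw
    refine ⟨u, hu, w, mem_sdiff.2 ⟨mem_insert.2 ?_, hw.2⟩, ha⟩
    exact (hT u (hXT hu) w hw.1 ha).symm
  intro X hX hne hne'
  by_cases hyX : y ∈ X
  · obtain ⟨u, hu, w, hw, ha⟩ := key (insert y T \ X) sdiff_subset (by simp [hyX]) hne'
    rw [Finset.sdiff_sdiff_eq_self hX] at hw
    exact ⟨w, hw, u, hu, ha.symm⟩
  · exact key X hX hyX hne

open scoped Classical in
/-- The colours of `y` that do not extend to `T`. -/
noncomputable def forbidden (G : SimpleGraph V) (L : V → Finset α) (y : V) (T : Finset V) :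
    Finset α :=
  (L y).filter fun c => ¬ Colourable G (insert y T) (Function.update L y {c})

/-- In such a colouring the colour of y would be forbidden, yet the colouring itself shows that it
extends to T. -/
theorem not_colourable_forbidden (L : V → Finset α) (y : V) (T : Finset V) :
    ¬ Colourable G (insert y T) (Function.update L y (forbidden G L y T)) := by
  rintro ⟨f, h1, h2⟩
  have hy := h1 y (mem_insert_self _ _)
  simp only [Function.update_self, forbidden, mem_filter] at hy
  refine hy.2 ⟨f, fun v hv => ?_, h2⟩
  by_cases hvy : v = y
  · subst hvy; simp
  · have := h1 v hv
    rw [Function.update_of_ne hvy] at this ⊢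
    exact this

/-- A colour forbidden on neither side gives colourings of both sides that agree at y and can be
glued. -/
theorem list_subset_forbidden_union {S T T' : Finset V} {y : V} {L : V → Finset α}
    (hST : S ⊆ insert y (T ∪ T')) (hTT' : ∀ u ∈ T, ∀ w ∈ T', ¬ G.Adj u w)
    (hyT : y ∉ T) (hc : ¬ Colourable G S L) :
    L y ⊆ forbidden G L y T ∪ forbidden G L y T' := by
  intro c hcy
  by_contra hcon
  simp only [forbidden, mem_union, mem_filter, hcy, true_and, not_or, not_not] at hcon
  obtain ⟨⟨f, f1, f2⟩, g, g1, g2⟩ := hcon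
  have hfy : f y = c := by simpa using f1 y (mem_insert_self _ _)
  have hgy : g y = c := by simpa using g1 y (mem_insert_self _ _)
  have f1' : ∀ v ∈ insert y T, f v ∈ L v := fun v hv => by
    by_cases hvy : v = y
    · subst hvy; rwa [hfy]
    · simpa [Function.update_of_ne hvy] using f1 v hv
  have g1' : ∀ v ∈ insert y T', g v ∈ L v := fun v hv => by
    by_cases hvy : v = y
    · subst hvy; rwa [hgy]
    · simpa [Function.update_of_ne hvy] using g1 v hv
  have hmem : ∀ v ∈ S, v ∉ T → v ∈ insert y T' := fun v hv hvT => by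
    have := hST hv
    simp only [mem_insert, mem_union] at this ⊢
    tauto
  have hcross : ∀ u ∈ T, ∀ w ∈ S, w ∉ T → G.Adj u w → f u ≠ g w := by
    intro u hu w hw hwT ha
    rcases mem_insert.1 (hmem w hw hwT) with rfl | hw'
    · rw [hgy, ← hfy]
      exact f2 u (mem_insert_of_mem hu) w (mem_insert_self _ _) ha
    · exact absurd ha (hTT' u hu w hw')
  refine hc ⟨fun v => if v ∈ T then f v else g v, fun v hv => ?_, fun u hu w hw ha => ?_⟩
  · by_cases hvT : v ∈ T
    · simpa [hvT] using f1' v (mem_insert_of_mem hvT)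
    · simpa [hvT] using g1' v (hmem v hv hvT)
  · by_cases huT : u ∈ T <;> by_cases hwT : w ∈ T <;> simp only [huT, hwT, if_true, if_false]
    · exact f2 u (mem_insert_of_mem huT) w (mem_insert_of_mem hwT) ha
    · exact hcross u huT w hw hwT ha
    · exact (hcross w hwT u hu huT ha.symm).symm
    · exact g2 u (hmem u hu huT) w (hmem w hw hwT) ha

/-- With more forbidden colours than neighbours in T, the vertex y would have slack, and its side
would be colourable with the forbidden colours as the list of y. -/
theorem card_forbidden_le [Nonempty α] {S T : Finset V} {y : V} {L : V → Finset α}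
    (hS : ConnOn G S) (hL : ∀ v ∈ S, degOn G S v ≤ (L v).card)
    (hTS : T ⊆ S.erase y) (hyS : y ∈ S)
    (hT : ∀ u ∈ T, ∀ w ∈ S, G.Adj u w → w ∈ T ∨ w = y) :
    (forbidden G L y T).card ≤ degOn G (insert y T) y := by
  by_contra! hlt
  refine not_colourable_forbidden L y T ((hS.insert_of_cut hTS hyS hT).colourable_of_lt
    (fun v hv => ?_) (mem_insert_self y T) (by simpa using hlt))
  by_cases hvy : v = y
  · subst hvy; simpa using hlt.le
  · rw [Function.update_of_ne hvy]
    have hsub : insert y T ⊆ S := insert_subset hyS (hTS.trans (erase_subset _ _))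
    exact (degOn_mono hsub v).trans (hL v (hsub hv))

theorem degOn_insert_self {T : Finset V} {y : V} : degOn G (insert y T) y = degOn G T y := by
  unfold degOn
  rw [filter_insert, if_neg (G.irrefl)]

/-! ### Refuting uncolourable graphs by two inference rules -/

/-- Two inference rules are enough to refute every uncolourable connected graph whose lists are at
least as long as the degrees: the pigeonhole principle on cliques, and the propagation of colours
along vertices with a common list of at most two colours. Here `M v` is the set of the colours
of `v` that are still possible. -/
theorem disjoint_of_not_colourable [Nonempty α] {M : V → Finset α}
    (hclique : ∀ (S : Finset V) (Λ : Finset α), ∀ x ∈ S, G.IsClique S → S.card = Λ.card + 1 →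
      (∀ u ∈ S, u ≠ x → M u ⊆ Λ) → Disjoint (M x) Λ)
    (hpair : ∀ (S : Finset V) (Λ : Finset α), ∀ x ∈ S, ConnOn G S → Λ.card ≤ 2 →
      ¬ Colourable G S (fun _ => Λ) → (∀ u ∈ S, u ≠ x → M u ⊆ Λ) → Disjoint (M x) Λ)
    (S : Finset V) : ∀ (L : V → Finset α), ∀ x ∈ S, ConnOn G S →
      (∀ v ∈ S, degOn G S v ≤ (L v).card) → ¬ Colourable G S L →
      (∀ u ∈ S, u ≠ x → M u ⊆ L u) → Disjoint (M x) (L x) := by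
  induction S using Finset.strongInduction with
  | H S ih =>
    intro L x hx hS hL hc hM
    by_cases hcut : ∀ v ∈ S, ConnOn G (S.erase v)
    · have hconst : ∀ u ∈ S, L u = L x := fun u hu => list_eq_of_no_cut hS hL hc hcut hu hx
      have hM' : ∀ u ∈ S, u ≠ x → M u ⊆ L x := fun u hu hux => hconst u hu ▸ hM u hu hux
      by_cases h2 : (L x).card ≤ 2
      · refine hpair S (L x) x hx hS h2 (fun ⟨f, f1, f2⟩ => hc ⟨f, fun v hv => ?_, f2⟩) hM'
        rw [hconst v hv]
        exact f1 v hv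
      · have hcl := isClique_of_no_cut hS hL hc hcut (fun v hv => by rw [hconst v hv]; omega)
        refine hclique S (L x) x hx hcl ?_ hM'
        -- In an uncolourable graph the common list is exactly as long as the degree, which in a
        -- clique is one less than the number of vertices.
        rw [hS.card_eq_degOn hL hc hx, degOn, ← card_erase_add_one hx]
        congr 2
        ext w
        simp only [mem_erase, mem_filter]
        exact ⟨fun h => ⟨h.2, hcl hx h.2 (Ne.symm h.1)⟩, fun h => ⟨h.2.ne', h.1⟩⟩
    · push Not at hcut
      obtain ⟨y, hy, hcut⟩ := hcut
      unfold ConnOn at hcut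
      push Not at hcut
      obtain ⟨T, hTS, hTne, hT'ne, hTT'⟩ := hcut
      set T' := S.erase y \ T with hT'
      have hT'S : T' ⊆ S.erase y := sdiff_subset
      have hcov : S ⊆ insert y (T ∪ T') := fun v hv => by
        simp only [hT', mem_insert, mem_union, mem_sdiff, mem_erase]; tauto
      have hyT : y ∉ T := fun h => by simpa using hTS h
      have hyT' : y ∉ T' := fun h => by simpa using hT'S h
      have hTout : ∀ u ∈ T, ∀ w ∈ S, G.Adj u w → w ∈ T ∨ w = y := fun u hu w hw ha => by
        have h1 := hTT' u hu w
        have h2 := hcov hw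
        simp only [mem_insert, mem_union] at h2
        tauto
      have hT'out : ∀ u ∈ T', ∀ w ∈ S, G.Adj u w → w ∈ T' ∨ w = y := fun u hu w hw ha => by
        have h1 := fun hw => hTT' w hw u hu ha.symm
        have h2 := hcov hw
        simp only [mem_insert, mem_union] at h2
        tauto
      -- The list of y is no longer than the two forbidden sets together, these are bounded by the
      -- degrees of y into the two sides, and their sum is bounded by the list again. So equality
      -- holds throughout, and each side with its forbidden set as the list of y meets the
      -- hypotheses of the induction.
      have hsum : (forbidden G L y T).card = degOn G (insert y T) y ∧
          (forbidden G L y T').card = degOn G (insert y T') y := by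
        have h1 := card_forbidden_le hS hL hTS hy hTout
        have h2 := card_forbidden_le hS hL hT'S hy hT'out
        have h3 := (card_le_card (list_subset_forbidden_union hcov hTT' hyT hc)).trans
          (card_union_le _ _)
        have h4 := hL y hy
        have h5 : degOn G (insert y T) y + degOn G (insert y T') y ≤ degOn G S y := by
          rw [degOn_insert_self, degOn_insert_self]
          unfold degOn
          rw [← card_union_of_disjoint (disjoint_filter_filter disjoint_sdiff), ← filter_union]
          exact card_le_card (filter_subset_filter _ (union_subset
            (hTS.trans (erase_subset _ _)) (hT'S.trans (erase_subset _ _))))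
        omega
      have hsplit := list_subset_forbidden_union hcov hTT' hyT hc
      have main : ∀ X : Finset V, X ⊆ S.erase y → (S.erase y \ X).Nonempty →
          (∀ u ∈ X, ∀ w ∈ S, G.Adj u w → w ∈ X ∨ w = y) →
          (forbidden G L y X).card = degOn G (insert y X) y → ∀ z ∈ insert y X,
          (∀ u ∈ insert y X, u ≠ z → M u ⊆ Function.update L y (forbidden G L y X) u) →
          Disjoint (M z) (Function.update L y (forbidden G L y X) z) := by
        intro X hX ⟨e, he⟩ hXout hcard z hz hMz
        have hsub : insert y X ⊆ S := insert_subset hy (hX.trans (erase_subset _ _))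
        refine ih (insert y X) ⟨hsub, fun h => ?_⟩ _ z hz (hS.insert_of_cut hX hy hXout)
          (fun v hv => ?_) (not_colourable_forbidden L y X) hMz
        · simp only [mem_sdiff, mem_erase] at he
          have := h he.1.2
          simp only [mem_insert] at this
          tauto
        · by_cases hvy : v = y
          · subst hvy; simp [hcard]
          · rw [Function.update_of_ne hvy]
            exact (degOn_mono hsub v).trans (hL v (hsub hv))
      have hTc : (S.erase y \ T').Nonempty := by
        rw [hT', Finset.sdiff_sdiff_eq_self hTS]; exact hTne
      have hother : ∀ X : Finset V, X ⊆ S.erase y →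
          (∀ u ∈ insert y X, u ≠ y → u ≠ x) → ∀ u ∈ insert y X, u ≠ y →
          M u ⊆ Function.update L y (forbidden G L y X) u := by
        intro X hX hxX u hu huy
        rw [Function.update_of_ne huy]
        exact hM u (insert_subset hy (hX.trans (erase_subset _ _)) hu) (hxX u hu huy)
      -- If x lies in X, the induction on the other side, with target y, excludes at y the colours
      -- forbidden by X'. What is left at y is forbidden by X, so the induction on the side of x
      -- applies with target x.
      have step : ∀ X X' : Finset V, X ⊆ S.erase y → X' ⊆ S.erase y →
          (S.erase y \ X).Nonempty → (S.erase y \ X').Nonempty → Disjoint X X' →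
          (∀ u ∈ X, ∀ w ∈ S, G.Adj u w → w ∈ X ∨ w = y) →
          (∀ u ∈ X', ∀ w ∈ S, G.Adj u w → w ∈ X' ∨ w = y) →
          (forbidden G L y X).card = degOn G (insert y X) y →
          (forbidden G L y X').card = degOn G (insert y X') y →
          L y ⊆ forbidden G L y X ∪ forbidden G L y X' → x ∈ X → Disjoint (M x) (L x) := by
        intro X X' hX hX' hXn hX'n hdisj hXo hX'o hXc hX'c hLy hxX
        have hxy : x ≠ y := fun h => by simpa [h] using hX hxX
        have h1 := main X' hX' hX'n hX'o hX'c y (mem_insert_self _ _)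
          (hother X' hX' (fun u hu huy hux => by
            rw [mem_insert] at hu
            exact disjoint_left.1 hdisj hxX (hux ▸ hu.resolve_left huy)))
        rw [Function.update_self] at h1
        have h2 := main X hX hXn hXo hXc x (mem_insert_of_mem hxX) (fun u hu hux => by
          by_cases huy : u = y
          · subst huy
            rw [Function.update_self]
            intro c hcu
            have := hLy (hM u hy hux hcu)
            rw [mem_union] at this
            exact this.resolve_right (disjoint_left.1 h1 hcu)
          · rw [Function.update_of_ne huy]
            exact hM u (insert_subset hy (hX.trans (erase_subset _ _)) hu) hux)
        rwa [Function.update_of_ne hxy] at h2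
      rcases mem_insert.1 (hcov hx) with rfl | hx'
      · have hne : ∀ X : Finset V, ∀ u ∈ insert x X, u ≠ x → u ≠ x := fun _ _ _ h => h
        have h1 := main T hTS hT'ne hTout hsum.1 x (mem_insert_self _ _)
          (hother T hTS (hne T))
        have h2 := main T' hT'S hTc hT'out hsum.2 x (mem_insert_self _ _)
          (hother T' hT'S (hne T'))
        rw [Function.update_self] at h1 h2
        exact (disjoint_union_right.2 ⟨h1, h2⟩).mono_right hsplit
      · rcases mem_union.1 hx' with hxT | hxT
        · exact step T T' hTS hT'S hT'ne hTc disjoint_sdiff hTout hT'out hsum.1 hsum.2 hsplit hxT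
        · exact step T' T hT'S hTS hTc hT'ne disjoint_sdiff.symm hT'out hTout hsum.2 hsum.1
            (by rwa [union_comm]) hxT

/-- An uncolourable graph has a nonempty connected uncolourable induced subgraph. -/
theorem exists_connOn_not_colourable [Nonempty α] {S : Finset V} {L : V → Finset α}
    (h : ¬ Colourable G S L) :
    ∃ T ⊆ S, T.Nonempty ∧ ConnOn G T ∧ ¬ Colourable G T L := by
  induction S using Finset.strongInduction with
  | H S ih =>
    by_cases hS : ConnOn G S
    · refine ⟨S, Subset.rfl, ?_, hS, h⟩
      by_contra hne
      rw [not_nonempty_iff_eq_empty] at hne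
      subst hne
      exact h ⟨fun _ => Classical.arbitrary α, by simp, by simp⟩
    · unfold ConnOn at hS
      push Not at hS
      obtain ⟨T, hT, ⟨t, ht⟩, ⟨e, he⟩, hTT⟩ := hS
      by_cases h1 : Colourable G T L
      · by_cases h2 : Colourable G (S \ T) L
        · obtain ⟨f, f1, f2⟩ := h1
          obtain ⟨g, g1, g2⟩ := h2
          refine absurd ⟨fun v => if v ∈ T then f v else g v, fun v hv => ?_,
            fun u hu w hw ha => ?_⟩ h
          · by_cases hvT : v ∈ T
            · simpa [hvT] using f1 v hvT
            · simpa [hvT] using g1 v (mem_sdiff.2 ⟨hv, hvT⟩)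
          · by_cases huT : u ∈ T <;> by_cases hwT : w ∈ T <;>
              simp only [huT, hwT, if_true, if_false]
            · exact f2 u huT w hwT ha
            · exact absurd ha (hTT u huT w (mem_sdiff.2 ⟨hw, hwT⟩))
            · exact absurd ha.symm (hTT w hwT u (mem_sdiff.2 ⟨hu, huT⟩))
            · exact g2 u (mem_sdiff.2 ⟨hu, huT⟩) w (mem_sdiff.2 ⟨hw, hwT⟩) ha
        · obtain ⟨X, hX, hX'⟩ := ih (S \ T)
            ⟨sdiff_subset, fun h => (mem_sdiff.1 (h (hT ht))).2 ht⟩ h2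
          exact ⟨X, hX.trans sdiff_subset, hX'⟩
      · obtain ⟨X, hX, hX'⟩ := ih T
          ⟨hT, fun h => (mem_sdiff.1 he).2 (h (mem_sdiff.1 he).1)⟩ h1
        exact ⟨X, hX.trans hT, hX'⟩

end ListColouring

/-! ### Consistent binary constraints yield an extension -/

namespace PrecolouringInstance

set_option linter.unusedSectionVars false

open ListColouring

/-- The local solutions of binary constraints `R` on the positions `Fin m`. -/
def IsLocalSolution {k m : ℕ} (R : Fin m → Fin m → Fin k → Fin k → Bool) (f : Fin m → Fin k) :
    Prop :=
  ∀ i j, R i j (f i) (f j) = true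

variable {k : ℕ}

/-- Constraints `R` on pairs of vertices are consistent if an allowed pair of colours on two
vertices always extends to a solution on each tuple of vertices that starts with the two. -/
def IsConsistent {V : Type*} (k : ℕ) (R : V → V → Fin k → Fin k → Bool) : Prop :=
  ∀ (v : Fin (k + 2) → V) (a b : Fin k), R (v 0) (v 1) a b = true →
    ∃ f : Fin (k + 2) → Fin k, f 0 = a ∧ f 1 = b ∧ IsLocalSolution (fun i j => R (v i) (v j)) f

section Consistent

variable {V : Type*} [DecidableEq V] {G : SimpleGraph V} [DecidableRel G.Adj]
  {R : V → V → Fin k → Fin k → Bool}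

/-- The colours of a vertex that the constraints still allow. -/
def allowed (R : V → V → Fin k → Fin k → Bool) (v : V) : Finset (Fin k) :=
  Finset.univ.filter fun a => R v v a a = true

theorem mem_allowed {v : V} {a : Fin k} : a ∈ allowed R v ↔ R v v a a = true := by
  simp [allowed]

theorem IsConsistent.allowed_of_rel (hR : IsConsistent k R) {u v : V} {a b : Fin k}
    (h : R u v a b = true) : a ∈ allowed R u ∧ b ∈ allowed R v := by
  obtain ⟨f, rfl, rfl, hf⟩ := hR (fun i => if i = 0 then u else v) a b (by simpa using h)
  rw [mem_allowed, mem_allowed]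
  exact ⟨by simpa using hf 0 0, by simpa using hf 1 1⟩

/-- An allowed pair on `u`, `v` extends to any third vertex. -/
theorem IsConsistent.exists_rel_of_rel (hR : IsConsistent k R) {u v : V} {a b : Fin k}
    (h : R u v a b = true) (w : V) : ∃ c, R u w a c = true ∧ R w v c b = true := by
  obtain ⟨f, rfl, rfl, hf⟩ := hR (fun i => if i = 0 then u else if i = 1 then v else w) a b
    (by simpa using h)
  have hk : 0 < k := (f 0).pos
  have h20 : (⟨2, by omega⟩ : Fin (k + 2)) ≠ 0 := by simp [Fin.ext_iff]
  have h21 : (⟨2, by omega⟩ : Fin (k + 2)) ≠ 1 := by simp [Fin.ext_iff]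
  refine ⟨f ⟨2, by omega⟩, ?_, ?_⟩
  · simpa [h20, h21] using hf 0 ⟨2, by omega⟩
  · simpa [h20, h21] using hf ⟨2, by omega⟩ 1

/-- A colour a of x in Λ would extend to a local solution on a tuple that contains the whole clique,
colouring its |Λ| + 1 vertices injectively from Λ. The set Λ has at most k colours, so at most k
vertices besides x are needed. -/
theorem IsConsistent.clique_rule (hR : IsConsistent k R)
    (hadj : ∀ u v a b, G.Adj u v → R u v a b = true → a ≠ b) (S : Finset V) (Λ : Finset (Fin k))
    (x : V) (hx : x ∈ S) (hS : G.IsClique S) (hcard : S.card = Λ.card + 1)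
    (hM : ∀ u ∈ S, u ≠ x → allowed R u ⊆ Λ) : Disjoint (allowed R x) Λ := by
  rw [Finset.disjoint_left]
  intro a hax haΛ
  obtain ⟨g, hg⟩ : ∃ g : Fin k → V, ∀ w ∈ S.erase x, ∃ i, g i = w := by
    have hle : (S.erase x).card ≤ k := by
      rw [Finset.card_erase_of_mem hx, hcard]
      simpa using Finset.card_le_univ Λ
    -- Positions beyond the clique are filled with x again.
    refine ⟨fun i => if h : (i : ℕ) < (S.erase x).card then
      ((S.erase x).equivFin.symm ⟨i, h⟩ : V) else x, fun w hw => ?_⟩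
    refine ⟨⟨(S.erase x).equivFin ⟨w, hw⟩, ((S.erase x).equivFin ⟨w, hw⟩).2.trans_le hle⟩, ?_⟩
    simp
  have : Nonempty (Fin k) := ⟨a⟩
  choose! idx hidx using hg
  rw [mem_allowed] at hax
  -- Consistency extends a pair on positions 0 and 1, so x occupies both, and k positions remain for
  -- the rest of the clique.
  obtain ⟨f, hf0, -, hf⟩ := hR (Fin.cons x (Fin.cons x g)) a a (by simpa using hax)
  let p : V → Fin (k + 2) := fun w => if w = x then 0 else (idx w).succ.succ
  have hp : ∀ w ∈ S, (Fin.cons x (Fin.cons x g : Fin (k + 1) → V) : Fin (k + 2) → V) (p w) = w := by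
    intro w hw
    by_cases hwx : w = x
    · simp [p, hwx]
    · simp [p, hwx, hidx w (Finset.mem_erase.2 ⟨hwx, hw⟩)]
  obtain ⟨u, hu, w, hw, huw, he⟩ := Finset.exists_ne_map_eq_of_card_lt_of_maps_to
    (s := S) (t := Λ) (f := fun w => f (p w)) (by omega) (fun w hw => by
      by_cases hwx : w = x
      · simpa [p, hwx, hf0] using haΛ
      · refine hM w hw hwx (mem_allowed.2 ?_)
        have := hf (p w) (p w)
        beta_reduce at this
        rwa [hp w hw] at this)
  have := hf (p u) (p w)
  beta_reduce at this
  rw [hp u hu, hp w hw] at this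
  exact hadj u w _ _ (hS hu hw huw) this he

/-- Fix a colour a of x in Λ. Compatibility with a at x leaves each vertex of S only colours in Λ,
and along an edge a colour determines the other one, as there are at most two. By connectivity every
vertex has a unique compatible colour, and these colours form a proper colouring from Λ. -/
theorem IsConsistent.pair_rule (hR : IsConsistent k R)
    (hdiag : ∀ v a b, R v v a b = true → a = b)
    (hadj : ∀ u v a b, G.Adj u v → R u v a b = true → a ≠ b) (S : Finset V) (Λ : Finset (Fin k))
    (x : V) (hx : x ∈ S) (hS : ConnOn G S) (hcard : Λ.card ≤ 2)
    (hc : ¬ Colourable G S (fun _ => Λ)) (hM : ∀ u ∈ S, u ≠ x → allowed R u ⊆ Λ) :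
    Disjoint (allowed R x) Λ := by
  classical
  rw [Finset.disjoint_left]
  intro a hax haΛ
  rw [mem_allowed] at hax
  have hΛ : ∀ u ∈ S, ∀ d, R x u a d = true → d ∈ Λ := by
    intro u hu d hd
    by_cases hux : u = x
    · subst hux
      rwa [← hdiag _ _ _ hd]
    · exact hM u hu hux (hR.allowed_of_rel hd).2
  have hthree : ∀ c ∈ Λ, ∀ d ∈ Λ, ∀ e ∈ Λ, c ≠ d → c ≠ e → d = e := by
    intro c hc d hd e he hcd hce
    by_contra hde
    have h1 : ({c, d, e} : Finset (Fin k)) ⊆ Λ := by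
      intro y hy
      simp only [Finset.mem_insert, Finset.mem_singleton] at hy
      rcases hy with rfl | rfl | rfl <;> assumption
    have h2 := Finset.card_le_card h1
    rw [Finset.card_eq_three.2 ⟨c, d, e, hcd, hce, hde, rfl⟩] at h2
    omega
  have huniq : ∀ u ∈ S, ∀ d e, R x u a d = true → R x u a e = true → d = e := by
    by_contra! hcon
    obtain ⟨w, hw, d₀, e₀, hd₀, he₀, hne₀⟩ := hcon
    -- The vertices with a determined colour include x; if they are not all of S, an edge leads out
    -- of them, and uniqueness passes along that edge.
    obtain ⟨u, hu, v, hv, ha⟩ := hS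
      (S.filter fun u => ∀ d e, R x u a d = true → R x u a e = true → d = e)
      (Finset.filter_subset _ _)
      ⟨x, Finset.mem_filter.2 ⟨hx, fun d e hd he => (hdiag _ _ _ hd).symm.trans (hdiag _ _ _ he)⟩⟩
      ⟨w, Finset.mem_sdiff.2 ⟨hw, fun h => hne₀ ((Finset.mem_filter.1 h).2 d₀ e₀ hd₀ he₀)⟩⟩
    rw [Finset.mem_filter] at hu
    rw [Finset.mem_sdiff, Finset.mem_filter] at hv
    refine hv.2 ⟨hv.1, fun d e hd he => ?_⟩
    obtain ⟨c, hc1, hc2⟩ := hR.exists_rel_of_rel hd u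
    obtain ⟨c', hc1', hc2'⟩ := hR.exists_rel_of_rel he u
    obtain rfl := hu.2 c c' hc1 hc1'
    exact hthree c (hΛ u hu.1 c hc1) d (hΛ v hv.1 d hd) e (hΛ v hv.1 e he)
      (hadj _ _ _ _ ha hc2) (hadj _ _ _ _ ha hc2')
  have hex : ∀ u, ∃ d, R x u a d = true := fun u =>
    (hR.exists_rel_of_rel hax u).imp fun _ h => h.1
  choose col hcol using hex
  refine hc ⟨col, fun v hv => hΛ v hv _ (hcol v), fun u hu v hv ha => ?_⟩
  obtain ⟨c, hc1, hc2⟩ := hR.exists_rel_of_rel (hcol u) v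
  rw [huniq v hv _ _ hc1 (hcol v)] at hc2
  exact (hadj _ _ _ _ ha.symm hc2).symm

end Consistent

/-- For graphs of maximum degree at most `k`, nonempty consistent constraints guarantee that the
precolouring extends. -/
theorem hasExtension_of_isConsistent (hk : 0 < k) (I : PrecolouringInstance k)
    (hI : I ∈ maxDegreeAtMost k k) {R : Fin I.n → Fin I.n → Fin k → Fin k → Bool}
    (hR : IsConsistent k R) (hne : ∀ u v, ∃ a b, R u v a b = true)
    (hdiag : ∀ v a b, R v v a b = true → a = b)
    (hadj : ∀ u v a b, I.graph.Adj u v → R u v a b = true → a ≠ b)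
    (hpre : ∀ u v a b p, R u v a b = true → I.precolour v = some p → b = p) :
    I.HasExtension := by
  classical
  have : Nonempty (Fin k) := ⟨⟨0, hk⟩⟩
  have hpre' : ∀ u v a b p, R u v a b = true → I.precolour u = some p → a = p :=
    fun u v a b p h hp => hpre u u a a p (mem_allowed.1 (hR.allowed_of_rel h).1) hp
  let U : Finset (Fin I.n) := Finset.univ.filter fun v => I.precolour v = none
  let L : Fin I.n → Finset (Fin k) := fun u =>
    Finset.univ.filter fun a => ∀ w, I.graph.Adj u w → I.precolour w ≠ some a
  have hcol : Colourable I.graph U L := by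
    by_contra hcol
    obtain ⟨T, hTU, ⟨x, hx⟩, hT, hTcol⟩ := exists_connOn_not_colourable hcol
    have hM : ∀ u, allowed R u ⊆ L u := by
      intro u a ha
      simp only [L, Finset.mem_filter, Finset.mem_univ, true_and]
      intro w hw hwa
      obtain ⟨c, hc, -⟩ := hR.exists_rel_of_rel (mem_allowed.1 ha) w
      exact hadj _ _ _ _ hw hc (hpre _ _ _ _ _ hc hwa).symm
    have hdisj := disjoint_of_not_colourable (G := I.graph) (M := allowed R)
      (fun S Λ x hx => hR.clique_rule hadj S Λ x hx) (fun S Λ x hx => hR.pair_rule hdiag hadj S Λ x hx)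
      T L x hx hT (fun v _ => ?_) hTcol (fun u _ _ => hM u)
    · obtain ⟨a, b, hab⟩ := hne x x
      have ha := (hR.allowed_of_rel hab).1
      exact Finset.disjoint_left.1 hdisj ha (hM x ha)
    · have h1 : (Finset.univ.filter (I.graph.Adj v)).card ≤ k := by
        have := (I.graph.degree_le_maxDegree v).trans hI
        rw [← SimpleGraph.card_neighborFinset_eq_degree, SimpleGraph.neighborFinset_eq_filter]
          at this
        convert this
      -- The neighbours of v, at most k in number, are split into uncoloured ones, which bound its
      -- degree in T, and precoloured ones, which bound the number of colours missing from its list.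
      have h2 := Finset.card_filter_add_card_filter_not
        (s := Finset.univ.filter (I.graph.Adj v)) (fun w => I.precolour w = none)
      have h3 : degOn I.graph T v ≤ ((Finset.univ.filter (I.graph.Adj v)).filter
          fun w => I.precolour w = none).card := by
        refine Finset.card_le_card fun w hw => ?_
        rw [Finset.mem_filter] at hw
        have := hTU hw.1
        simp only [U, Finset.mem_filter, Finset.mem_univ, true_and] at this ⊢
        exact ⟨hw.2, this⟩
      have h4 : (Finset.univ \ L v).card ≤ ((Finset.univ.filter (I.graph.Adj v)).filter
          fun w => ¬ I.precolour w = none).card := by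
        have : (Finset.univ \ L v) ⊆ (((Finset.univ.filter (I.graph.Adj v)).filter
            fun w => ¬ I.precolour w = none).image
              fun w => (I.precolour w).getD ⟨0, hk⟩) := by
          intro a ha
          simp only [L, Finset.mem_sdiff, Finset.mem_filter, Finset.mem_univ, true_and, not_forall,
            not_not, Finset.mem_image] at ha ⊢
          obtain ⟨w, hw, hwa⟩ := ha
          exact ⟨w, ⟨hw, by simp [hwa]⟩, by simp [hwa]⟩
        exact (Finset.card_le_card this).trans Finset.card_image_le
      rw [Finset.card_sdiff_of_subset (Finset.subset_univ _), Finset.card_univ, Fintype.card_fin]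
        at h4
      omega
  obtain ⟨f, f1, f2⟩ := hcol
  have hU : ∀ v, I.precolour v = none → v ∈ U := fun v hv => by simp [U, hv]
  have hL : ∀ u v p, I.precolour u = none → I.precolour v = some p → I.graph.Adj u v →
      f u ≠ p := by
    rintro u v p hu hv ha rfl
    have := f1 u (hU u hu)
    simp only [L, Finset.mem_filter, Finset.mem_univ, true_and] at this
    exact this v ha hv
  refine ⟨SimpleGraph.Coloring.mk (fun v => (I.precolour v).getD (f v)) fun {u v} ha => ?_,
    fun v a hv => by change (I.precolour v).getD (f v) = a; simp [hv]⟩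
  rcases hu : I.precolour u with _ | p <;> rcases hv : I.precolour v with _ | q
  · simpa using f2 u (hU u hu) v (hU v hv) ha
  · simpa using hL u v q hu hv ha
  · simpa using (hL v u p hv hu ha.symm).symm
  · obtain ⟨a, b, hab⟩ := hne u v
    rw [Option.getD_some, Option.getD_some, ← hpre _ _ _ _ _ hab hv, ← hpre' _ _ _ _ _ hab hu]
    exact hadj _ _ _ _ ha hab

end PrecolouringInstance

/-! ### Structured programs on stack machines -/

namespace StackProg

open Turing

/-- Elementary actions of a machine with stacks `Γ` and finite memory `σ`. -/
inductive Act {K : Type} (Γ : K → Type) (σ : Type)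
  | push (k : K) (f : σ → Γ k) : Act Γ σ
  | peek (k : K) (f : σ → Option (Γ k) → σ) : Act Γ σ
  | pop (k : K) (f : σ → Option (Γ k) → σ) : Act Γ σ
  | load (f : σ → σ) : Act Γ σ

/-- Structured programs: `loop a b p` performs `a`, then leaves the loop if `b` fails, and
otherwise performs `p` and starts again. -/
inductive Prog {K : Type} (Γ : K → Type) (σ : Type)
  | act (a : Act Γ σ) : Prog Γ σ
  | seq (p q : Prog Γ σ) : Prog Γ σ
  | loop (a : Act Γ σ) (b : σ → Bool) (p : Prog Γ σ) : Prog Γ σ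

variable {K : Type} [DecidableEq K] {Γ : K → Type} {σ Λ : Type}

/-- Memory and stacks. -/
abbrev Mem (Γ : K → Type) (σ : Type) : Type := σ × ∀ k, List (Γ k)

/-- The effect of an action. -/
def Act.run : Act Γ σ → Mem Γ σ → Mem Γ σ
  | .push k f, (v, S) => (v, Function.update S k (f v :: S k))
  | .peek k f, (v, S) => (f v (S k).head?, S)
  | .pop k f, (v, S) => (f v (S k).head?, Function.update S k (S k).tail)
  | .load f, (v, S) => (f v, S)

/-- The statement that performs an action and then `q`. -/
def Act.stmt : Act Γ σ → TM2.Stmt Γ Λ σ → TM2.Stmt Γ Λ σ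
  | .push k f, q => .push k f q
  | .peek k f, q => .peek k f q
  | .pop k f, q => .pop k f q
  | .load f, q => .load f q

theorem Act.stepAux_stmt (a : Act Γ σ) (q : TM2.Stmt Γ Λ σ) (s : Mem Γ σ) :
    TM2.stepAux (a.stmt q) s.1 s.2 = TM2.stepAux q (a.run s).1 (a.run s).2 := by
  cases a <;> rfl

/-- `Exec p s t s'`: the program `p`, started in `s`, stops in `s'` after `t` steps. -/
inductive Exec : Prog Γ σ → Mem Γ σ → ℕ → Mem Γ σ → Prop
  | act (a : Act Γ σ) (s : Mem Γ σ) : Exec (.act a) s 1 (a.run s)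
  | seq {p q : Prog Γ σ} {s s₁ s₂ : Mem Γ σ} {t t₁ : ℕ} :
      Exec p s t s₁ → Exec q s₁ t₁ s₂ → Exec (.seq p q) s (t + t₁) s₂
  | halt {a : Act Γ σ} {b : σ → Bool} {p : Prog Γ σ} {s : Mem Γ σ} :
      b (a.run s).1 = false → Exec (.loop a b p) s 1 (a.run s)
  | cont {a : Act Γ σ} {b : σ → Bool} {p : Prog Γ σ} {s s₁ s₂ : Mem Γ σ} {t t₁ : ℕ} :
      b (a.run s).1 = true → Exec p (a.run s) t s₁ → Exec (.loop a b p) s₁ t₁ s₂ →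
      Exec (.loop a b p) s (1 + t + t₁) s₂

/-- The labels of the machine that runs a program. -/
def Prog.Label : Prog Γ σ → Type
  | .act _ => Unit
  | .seq p q => p.Label ⊕ q.Label
  | .loop _ _ p => Option p.Label

instance Prog.finite_label : (p : Prog Γ σ) → Finite p.Label
  | .act _ => inferInstanceAs (Finite Unit)
  | .seq p q =>
    have := p.finite_label
    have := q.finite_label
    inferInstanceAs (Finite (p.Label ⊕ q.Label))
  | .loop _ _ p =>
    have := p.finite_label
    inferInstanceAs (Finite (Option p.Label))

/-- The label at which a program starts. -/
def Prog.entry : (p : Prog Γ σ) → p.Label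
  | .act _ => ()
  | .seq p _ => Sum.inl p.entry
  | .loop _ _ _ => none

/-- The machine code of a program, with labels renamed by `e`, continuing at `x`. -/
def Prog.code : (p : Prog Γ σ) → (p.Label → Λ) → Λ → p.Label → TM2.Stmt Γ Λ σ
  | .act a, _, x, _ => a.stmt (.goto fun _ => x)
  | .seq p q, e, x, l => match l with
    | Sum.inl l => p.code (fun l => e (Sum.inl l)) (e (Sum.inr q.entry)) l
    | Sum.inr l => q.code (fun l => e (Sum.inr l)) x l
  | .loop a b p, e, x, l => match l with
    | none => a.stmt (.branch b (.goto fun _ => e (some p.entry)) (.goto fun _ => x))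
    | some l => p.code (fun l => e (some l)) (e none) l

/-- `Reach m c t c'`: the machine `m` gets from `c` to `c'` in `t` steps. -/
def Reach (m : Λ → TM2.Stmt Γ Λ σ) (c : TM2.Cfg Γ Λ σ) (t : ℕ) (c' : TM2.Cfg Γ Λ σ) : Prop :=
  (flip bind (TM2.step m))^[t] (some c) = some c'

theorem Reach.trans {m : Λ → TM2.Stmt Γ Λ σ} {c c' c'' : TM2.Cfg Γ Λ σ} {t t' : ℕ}
    (h : Reach m c t c') (h' : Reach m c' t' c'') : Reach m c (t + t') c'' := by
  unfold Reach at *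
  rw [add_comm, Function.iterate_add_apply, h, h']

theorem reach_one {m : Λ → TM2.Stmt Γ Λ σ} {l : Λ} {v : σ} {S : ∀ k, List (Γ k)} :
    Reach m ⟨some l, v, S⟩ 1 (TM2.stepAux (m l) v S) := rfl

/-- The renaming e and the exit label x are arbitrary, so that the induction applies to a subprogram
embedded in a larger machine; the body of a loop exits to the label of the loop. -/
theorem Exec.reach {m : Λ → TM2.Stmt Γ Λ σ} {p : Prog Γ σ} {s s' : Mem Γ σ} {t : ℕ}
    (h : Exec p s t s') : ∀ (e : p.Label → Λ) (x : Λ), (∀ l, m (e l) = p.code e x l) →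
      Reach m ⟨some (e p.entry), s.1, s.2⟩ t ⟨some x, s'.1, s'.2⟩ := by
  induction h with
  | act a s =>
    intro e x hm
    have := reach_one (m := m) (l := e (Prog.act a).entry) (v := s.1) (S := s.2)
    rw [hm, Prog.code, Act.stepAux_stmt] at this
    exact this
  | @seq p q s s' s'' t t' h1 h2 ih1 ih2 =>
    intro e x hm
    exact (ih1 (fun l => e (Sum.inl l)) _ (fun l => hm (Sum.inl l))).trans
      (ih2 (fun l => e (Sum.inr l)) x (fun l => hm (Sum.inr l)))
  | @halt a b p s hb =>
    intro e x hm
    have := reach_one (m := m) (l := e (Prog.loop a b p).entry) (v := s.1) (S := s.2)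
    rw [hm, Prog.entry, Prog.code, Act.stepAux_stmt, TM2.stepAux, hb] at this
    exact this
  | @cont a b p s s' s'' t t' hb h1 h2 ih1 ih2 =>
    intro e x hm
    have := reach_one (m := m) (l := e (Prog.loop a b p).entry) (v := s.1) (S := s.2)
    rw [hm, Prog.entry, Prog.code, Act.stepAux_stmt, TM2.stepAux, hb] at this
    exact (this.trans (ih1 (fun l => e (some l)) _ (fun l => hm (some l)))).trans (ih2 e x hm)

/-- `p` leads from `s` to `s'` within `t` steps. -/
def Runs (p : Prog Γ σ) (s : Mem Γ σ) (t : ℕ) (s' : Mem Γ σ) : Prop := ∃ t' ≤ t, Exec p s t' s'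

theorem Runs.act (a : Act Γ σ) (s : Mem Γ σ) : Runs (.act a) s 1 (a.run s) :=
  ⟨1, le_rfl, .act a s⟩

theorem Runs.mono {p : Prog Γ σ} {s s' : Mem Γ σ} {t t' : ℕ} (h : Runs p s t s') (ht : t ≤ t') :
    Runs p s t' s' :=
  let ⟨u, hu, h⟩ := h
  ⟨u, hu.trans ht, h⟩

theorem Runs.seq {p q : Prog Γ σ} {s s' s'' : Mem Γ σ} {t t' : ℕ} (h : Runs p s t s')
    (h' : Runs q s' t' s'') : Runs (.seq p q) s (t + t') s'' :=
  let ⟨_, hu, h⟩ := h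
  let ⟨_, hu', h'⟩ := h'
  ⟨_, add_le_add hu hu', .seq h h'⟩

theorem Runs.halt {a : Act Γ σ} {b : σ → Bool} {p : Prog Γ σ} {s : Mem Γ σ}
    (hb : b (a.run s).1 = false) : Runs (.loop a b p) s 1 (a.run s) :=
  ⟨1, le_rfl, .halt hb⟩

theorem Runs.cont {a : Act Γ σ} {b : σ → Bool} {p : Prog Γ σ} {s s' s'' : Mem Γ σ} {t t' : ℕ}
    (hb : b (a.run s).1 = true) (h : Runs p (a.run s) t s') (hl : Runs (.loop a b p) s' t' s'') :
    Runs (.loop a b p) s (1 + t + t') s'' :=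
  let ⟨_, hu, h⟩ := h
  let ⟨_, hu', hl⟩ := hl
  ⟨_, by omega, .cont hb h hl⟩

/-- The machine that runs the program `p` and halts. -/
noncomputable def Prog.machine [Fintype K] [Fintype σ] (p : Prog Γ σ) (k₀ k₁ : K)
    [Fintype (Γ k₀)] (v₀ : σ) : FinTM2 where
  K := K
  k₀ := k₀
  k₁ := k₁
  Γ := Γ
  Λ := Option p.Label
  main := some p.entry
  ΛFin := Fintype.ofFinite _
  σ := σ
  initialState := v₀
  m
    -- An output configuration must carry the initial memory, hence the reset before halting.
    | none => .load (fun _ => v₀) .halt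
    | some l => p.code some none l

/-- The additional step is the one at the exit label, which resets the memory and halts. -/
theorem Runs.evalsToInTime [Fintype K] [Fintype σ] {p : Prog Γ σ} {k₀ k₁ : K}
    [Fintype (Γ k₀)] {v₀ : σ} {s : Mem Γ σ} {t : ℕ} {w : List (Γ k₀)} {w' : List (Γ k₁)}
    (h : Runs p (v₀, (initList (p.machine k₀ k₁ v₀) w).stk) t s)
    (hs : s.2 = (haltList (p.machine k₀ k₁ v₀) w').stk) :
    Nonempty (TM2OutputsInTime (p.machine k₀ k₁ v₀) w (some w') (t + 1)) := by
  obtain ⟨t', ht', h⟩ := h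
  have h1 := h.reach (m := (p.machine k₀ k₁ v₀).m) some none (fun l => rfl)
  have h2 := h1.trans (reach_one (m := (p.machine k₀ k₁ v₀).m))
  refine ⟨⟨⟨t' + 1, ?_⟩, by simpa using ht'⟩⟩
  refine Eq.trans h2 ?_
  rw [hs]
  rfl

end StackProg

/-! ### A machine with two tape halves and unary counters -/

namespace ArrayProg

set_option linter.unusedSectionVars false

open Turing StackProg

/-- The unary stacks: a scratch counter and, for each index variable, its value and the number of
remaining rounds of its loop. -/
inductive Counter (ι : Type)
  | tmp : Counter ι
  | cnt (i : ι) : Counter ι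
  | rem (i : ι) : Counter ι
deriving DecidableEq

/-- The stacks of the machine. -/
inductive Stk (ι : Type)
  | inp : Stk ι
  | out : Stk ι
  | left : Stk ι
  | right : Stk ι
  | ctr (u : Counter ι) : Stk ι
deriving DecidableEq

instance {ι : Type} [Finite ι] : Finite (Stk ι) := by
  have h : Function.Injective (fun s : Stk ι => (match s with
    | .inp => Sum.inl 0
    | .out => Sum.inl 1
    | .left => Sum.inl 2
    | .right => Sum.inl 3
    | .ctr .tmp => Sum.inl 4
    | .ctr (.cnt i) => Sum.inr (i, false)
    | .ctr (.rem i) => Sum.inr (i, true) : Fin 5 ⊕ ι × Bool)) := by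
    rintro (_ | _ | _ | _ | _ | _ | _) (_ | _ | _ | _ | _ | _ | _) h <;> simp_all
  exact Finite.of_injective _ h

variable {ι σ A C A₀ C₀ : Type} [DecidableEq ι]

/-- The stack alphabets: the input has heads `A₀` and cells `C₀`, the array has heads `A` and cells
`C`. -/
abbrev Alph (ι A C A₀ C₀ : Type) : Stk ι → Type
  | .inp => A₀ ⊕ C₀
  | .out => Bool
  | .left => A ⊕ C
  | .right => A ⊕ C
  | .ctr _ => Unit

/-- The finite memory: the state of the array program, the last symbol read, a flag. -/
abbrev Reg (σ A C : Type) : Type := σ × Option (A ⊕ C) × Bool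

/-- Contents of state and stacks. -/
structure Conf (ι σ A C A₀ C₀ : Type) where
  /-- state of the array program -/
  s : σ
  /-- input stack -/
  inp : List (A₀ ⊕ C₀)
  /-- output stack -/
  out : List Bool
  /-- stack to the left of the reading position, reversed -/
  l : List (A ⊕ C)
  /-- stack to the right of the reading position -/
  r : List (A ⊕ C)
  /-- heights of the unary stacks -/
  un : Counter ι → ℕ

namespace Conf

/-- The stacks described by a configuration. -/
def stk (c : Conf ι σ A C A₀ C₀) : ∀ k, List (Alph ι A C A₀ C₀ k)
  | .inp => c.inp
  | .out => c.out
  | .left => c.l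
  | .right => c.r
  | .ctr u => List.replicate (c.un u) ()

/-- Configuration with the height of a unary stack changed. -/
def set (c : Conf ι σ A C A₀ C₀) (u : Counter ι) (n : ℕ) : Conf ι σ A C A₀ C₀ :=
  { c with un := Function.update c.un u n }

theorem update_inp (c : Conf ι σ A C A₀ C₀) (x : List (A₀ ⊕ C₀)) :
    Function.update c.stk .inp x = { c with inp := x }.stk := by
  funext k; cases k <;> simp [Function.update, stk]

theorem update_out (c : Conf ι σ A C A₀ C₀) (x : List Bool) :
    Function.update c.stk .out x = { c with out := x }.stk := by
  funext k; cases k <;> simp [Function.update, stk]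

theorem update_left (c : Conf ι σ A C A₀ C₀) (x : List (A ⊕ C)) :
    Function.update c.stk .left x = { c with l := x }.stk := by
  funext k; cases k <;> simp [Function.update, stk]

theorem update_right (c : Conf ι σ A C A₀ C₀) (x : List (A ⊕ C)) :
    Function.update c.stk .right x = { c with r := x }.stk := by
  funext k; cases k <;> simp [Function.update, stk]

theorem update_ctr (c : Conf ι σ A C A₀ C₀) (u : Counter ι) (n : ℕ) :
    Function.update c.stk (.ctr u) (List.replicate n ()) = (c.set u n).stk := by
  funext k
  cases k with
  | ctr w =>
    by_cases h : w = u
    · subst h; simp [stk, set]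
    · rw [Function.update_of_ne (by simpa using h)]
      simp [stk, set, h]
  | _ => simp [Function.update, stk, set]

end Conf

/-- Programs for the array machine. -/
abbrev AProg (ι σ A C A₀ C₀ : Type) : Type := Prog (Alph ι A C A₀ C₀) (Reg σ A C)

/-- The program leads from one configuration to another within `t` steps, whatever the auxiliary
registers contain. -/
def RunsTo (p : AProg ι σ A C A₀ C₀) (c : Conf ι σ A C A₀ C₀) (t : ℕ)
    (c' : Conf ι σ A C A₀ C₀) : Prop :=
  ∀ y : Option (A ⊕ C) × Bool, ∃ y', Runs p ((c.s, y), c.stk) t ((c'.s, y'), c'.stk)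

section

variable {p q : AProg ι σ A C A₀ C₀} {c c' c'' : Conf ι σ A C A₀ C₀} {t t' : ℕ}

theorem RunsTo.mono (h : RunsTo p c t c') (ht : t ≤ t') : RunsTo p c t' c' := fun y =>
  let ⟨y', h⟩ := h y
  ⟨y', h.mono ht⟩

theorem RunsTo.seq (h : RunsTo p c t c') (h' : RunsTo q c' t' c'') :
    RunsTo (.seq p q) c (t + t') c'' := fun y =>
  let ⟨y', h⟩ := h y
  let ⟨y'', h'⟩ := h' y'
  ⟨y'', h.seq h'⟩

end

section Actions

variable (c : Conf ι σ A C A₀ C₀) (v : Reg σ A C)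

/-- Actions of the array machine. -/
abbrev AAct (ι σ A C A₀ C₀ : Type) : Type := Act (Alph ι A C A₀ C₀) (Reg σ A C)

/-- Pop from a unary stack and record in the flag whether it was nonempty. -/
def popU (u : Counter ι) : AAct ι σ A C A₀ C₀ :=
  .pop (.ctr u) fun v o => (v.1, v.2.1, o.isSome)

/-- Push on a unary stack. -/
def pushU (u : Counter ι) : AAct ι σ A C A₀ C₀ := .push (.ctr u) fun _ => ()

/-- Pop from the right stack. -/
def popR (f : Reg σ A C → Option (A ⊕ C) → Reg σ A C) : AAct ι σ A C A₀ C₀ := .pop .right f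

/-- Inspect the right stack. -/
def peekR (f : Reg σ A C → Option (A ⊕ C) → Reg σ A C) : AAct ι σ A C A₀ C₀ := .peek .right f

/-- Push on the right stack. -/
def pushR (f : Reg σ A C → A ⊕ C) : AAct ι σ A C A₀ C₀ := .push .right f

/-- Pop from the left stack. -/
def popL (f : Reg σ A C → Option (A ⊕ C) → Reg σ A C) : AAct ι σ A C A₀ C₀ := .pop .left f

/-- Push on the left stack. -/
def pushL (f : Reg σ A C → A ⊕ C) : AAct ι σ A C A₀ C₀ := .push .left f

/-- Pop from the input stack. -/
def popI (f : Reg σ A C → Option (A₀ ⊕ C₀) → Reg σ A C) : AAct ι σ A C A₀ C₀ := .pop .inp f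

/-- Inspect the input stack. -/
def peekI (f : Reg σ A C → Option (A₀ ⊕ C₀) → Reg σ A C) : AAct ι σ A C A₀ C₀ := .peek .inp f

/-- Push on the output stack. -/
def pushO (f : Reg σ A C → Bool) : AAct ι σ A C A₀ C₀ := .push .out f

theorem run_popU (u : Counter ι) : (popU u : AAct ι σ A C A₀ C₀).run (v, c.stk) =
    ((v.1, v.2.1, decide (0 < c.un u)), (c.set u (c.un u - 1)).stk) := by
  refine Prod.ext ?_ ?_
  · change (v.1, v.2.1, (List.replicate (c.un u) ()).head?.isSome) = _
    cases c.un u <;> rfl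
  · have h := Conf.update_ctr c u (c.un u - 1)
    rw [← List.tail_replicate] at h
    exact h

theorem run_pushU (u : Counter ι) : (pushU u : AAct ι σ A C A₀ C₀).run (v, c.stk) =
    (v, (c.set u (c.un u + 1)).stk) :=
  Prod.ext rfl (Conf.update_ctr c u (c.un u + 1))

theorem run_popR (f) : (popR f : AAct ι σ A C A₀ C₀).run (v, c.stk) =
    (f v c.r.head?, { c with r := c.r.tail }.stk) :=
  Prod.ext rfl (Conf.update_right c _)

theorem run_peekR (f) : (peekR f : AAct ι σ A C A₀ C₀).run (v, c.stk) =
    (f v c.r.head?, c.stk) := rfl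

theorem run_pushR (f) : (pushR f : AAct ι σ A C A₀ C₀).run (v, c.stk) =
    (v, { c with r := f v :: c.r }.stk) :=
  Prod.ext rfl (Conf.update_right c _)

theorem run_popL (f) : (popL f : AAct ι σ A C A₀ C₀).run (v, c.stk) =
    (f v c.l.head?, { c with l := c.l.tail }.stk) :=
  Prod.ext rfl (Conf.update_left c _)

theorem run_pushL (f) : (pushL f : AAct ι σ A C A₀ C₀).run (v, c.stk) =
    (v, { c with l := f v :: c.l }.stk) :=
  Prod.ext rfl (Conf.update_left c _)

theorem run_popI (f) : (popI f : AAct ι σ A C A₀ C₀).run (v, c.stk) =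
    (f v c.inp.head?, { c with inp := c.inp.tail }.stk) :=
  Prod.ext rfl (Conf.update_inp c _)

theorem run_peekI (f) : (peekI f : AAct ι σ A C A₀ C₀).run (v, c.stk) =
    (f v c.inp.head?, c.stk) := rfl

theorem run_pushO (f) : (pushO f : AAct ι σ A C A₀ C₀).run (v, c.stk) =
    (v, { c with out := f v :: c.out }.stk) :=
  Prod.ext rfl (Conf.update_out c _)

end Actions

section Moves

variable {p q : AProg ι σ A C A₀ C₀} {c c' c'' : Conf ι σ A C A₀ C₀} {t t' : ℕ}

theorem RunsTo.of_act {a : AAct ι σ A C A₀ C₀}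
    (h : ∀ y, ∃ y', a.run ((c.s, y), c.stk) = ((c'.s, y'), c'.stk)) : RunsTo (.act a) c 1 c' :=
  fun y => by
    obtain ⟨y', hy⟩ := h y
    exact ⟨y', hy ▸ Runs.act a _⟩

/-- A loop that stops at once. -/
theorem RunsTo.of_halt {a : AAct ι σ A C A₀ C₀}
    (h : ∀ y, ∃ z, a.run ((c.s, y), c.stk) = ((c'.s, z, false), c'.stk)) :
    RunsTo (.loop a (fun v => v.2.2) p) c 1 c' := fun y => by
  obtain ⟨z, hz⟩ := h y
  refine ⟨(z, false), ?_⟩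
  rw [← hz]
  exact Runs.halt (by rw [hz])

/-- A loop that runs at least once, with the first run of the body given up to the symbol in the
register. -/
theorem RunsTo.of_cont {a : AAct ι σ A C A₀ C₀} {d : Conf ι σ A C A₀ C₀}
    (h : ∀ y, ∃ z, a.run ((c.s, y), c.stk) = ((d.s, z, true), d.stk) ∧
      ∃ y', Runs p ((d.s, z, true), d.stk) t ((c'.s, y'), c'.stk))
    (h' : RunsTo (.loop a (fun v => v.2.2) p) c' t' c'') :
    RunsTo (.loop a (fun v => v.2.2) p) c (1 + t + t') c'' := fun y => by
  obtain ⟨z, hz, y', hp⟩ := h y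
  obtain ⟨y'', h'⟩ := h' y'
  exact ⟨y'', Runs.cont (by rw [hz]) (by rw [hz]; exact hp) h'⟩

theorem RunsTo.of_cont' {a : AAct ι σ A C A₀ C₀} {d : Conf ι σ A C A₀ C₀}
    (h : ∀ y, ∃ z, a.run ((c.s, y), c.stk) = ((d.s, z, true), d.stk))
    (hp : RunsTo p d t c') (h' : RunsTo (.loop a (fun v => v.2.2) p) c' t' c'') :
    RunsTo (.loop a (fun v => v.2.2) p) c (1 + t + t') c'' :=
  RunsTo.of_cont (fun y => (h y).imp fun _ hz => ⟨hz, hp _⟩) h'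

theorem runsTo_pushU (u : Counter ι) (c : Conf ι σ A C A₀ C₀) :
    RunsTo (.act (pushU u)) c 1 (c.set u (c.un u + 1)) :=
  .of_act fun y => ⟨y, run_pushU c _ u⟩

/-- Repeat `p` while a unit can be popped from a unary stack. -/
def loopU (u : Counter ι) (p : AProg ι σ A C A₀ C₀) : AProg ι σ A C A₀ C₀ :=
  .loop (popU u) (fun v => v.2.2) p

theorem Conf.set_self {u : Counter ι} {n : ℕ} (h : c.un u = n) : c.set u n = c := by
  subst h
  simp [Conf.set]

theorem runsTo_loopU_zero {u : Counter ι} (h : c.un u = 0) : RunsTo (loopU u p) c 1 c :=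
  .of_halt fun y => ⟨y.1, by rw [run_popU, Conf.set_self (by simp [h])]; simp [h]⟩

theorem runsTo_loopU_succ {u : Counter ι} {n : ℕ} (h : c.un u = n + 1)
    (hp : RunsTo p (c.set u n) t c') (hl : RunsTo (loopU u p) c' t' c'') :
    RunsTo (loopU u p) c (1 + t + t') c'' :=
  .of_cont' (fun y => ⟨y.1, by rw [run_popU]; simp [h]; rfl⟩) hp hl

/-- Move all units from `u` to `w`. -/
def transfer (u w : Counter ι) : AProg ι σ A C A₀ C₀ := loopU u (.act (pushU w))

theorem runsTo_transfer {u w : Counter ι} (huw : u ≠ w) (n : ℕ) :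
    ∀ c : Conf ι σ A C A₀ C₀, c.un u = n →
      RunsTo (transfer u w) c (2 * n + 1) ((c.set u 0).set w (c.un w + n)) := by
  induction n with
  | zero =>
    intro c h
    rw [Conf.set_self h, Conf.set_self (by simp)]
    exact runsTo_loopU_zero h
  | succ n ih =>
    intro c h
    have hc : (c.set u 0).set w (c.un w + (n + 1)) =
        (((c.set u n).set w ((c.set u n).un w + 1)).set u 0).set w
          (((c.set u n).set w ((c.set u n).un w + 1)).un w + n) := by
      simp only [Conf.set, Function.update_self, Function.update_of_ne huw.symm, Conf.mk.injEq,
        true_and]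
      funext z
      by_cases h1 : z = w
      · subst h1; simp; omega
      · by_cases h2 : z = u
        · subst h2; simp [huw]
        · simp [h1, h2]
    rw [hc]
    exact (runsTo_loopU_succ h (runsTo_pushU w _) (ih _ (by simp [Conf.set, huw]))).mono (by omega)

variable [Inhabited A]

/-- The symbol in the register. -/
def symbol (v : Reg σ A C) : A ⊕ C := v.2.1.getD (Sum.inl default)

/-- Move one symbol from the right stack to the left one. -/
def moveRight : AProg ι σ A C A₀ C₀ :=
  .seq (.act (popR fun v o => (v.1, o, v.2.2))) (.act (pushL symbol))

theorem runsTo_moveRight {a : A ⊕ C} {r : List (A ⊕ C)} (h : c.r = a :: r) :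
    RunsTo moveRight c 2 { c with r := r, l := a :: c.l } := by
  intro y
  have h1 := Runs.act (popR fun v o => (v.1, o, v.2.2)) ((c.s, y), c.stk)
  rw [run_popR, h] at h1
  have h2 := Runs.act (pushL symbol) ((c.s, some a, y.2), { c with r := r }.stk)
  rw [run_pushL] at h2
  exact ⟨_, h1.seq h2⟩

/-- The test whether the top of a stack is a cell. -/
def isCell {X Y : Type} (o : Option (X ⊕ Y)) : Bool := o.elim false Sum.isRight

/-- Move symbols from the right stack to the left one as long as they are cells. -/
def moveCells : AProg ι σ A C A₀ C₀ :=
  .loop (peekR fun v o => (v.1, v.2.1, isCell o)) (fun v => v.2.2) moveRight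

theorem runsTo_moveCells {r : List (A ⊕ C)} (hr : isCell r.head? = false) (cs : List C) :
    ∀ c : Conf ι σ A C A₀ C₀, c.r = cs.map Sum.inr ++ r →
      RunsTo moveCells c (3 * cs.length + 1)
        { c with r := r, l := (cs.map Sum.inr).reverse ++ c.l } := by
  induction cs with
  | nil =>
    intro c h
    refine .of_halt fun y => ⟨y.1, ?_⟩
    rw [run_peekR, h]
    have hc : c = { c with r := r } := by cases c; simp_all
    simp only [List.map_nil, List.nil_append, hr, List.reverse_nil]
    rw [← hc]
  | cons b cs ih =>
    intro c h
    have := RunsTo.of_cont' (c := c) (d := c) (fun y => ⟨y.1, by rw [run_peekR, h]; rfl⟩)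
      (runsTo_moveRight (a := Sum.inr b) (r := cs.map Sum.inr ++ r) (by simp [h])) (ih _ rfl)
    simp only [List.map_cons, List.reverse_cons, List.append_assoc, List.singleton_append]
    exact this.mono (by simp; omega)

/-- Move the left stack back to the right one. -/
def rewind : AProg ι σ A C A₀ C₀ :=
  .loop (popL fun v o => (v.1, o, o.isSome)) (fun v => v.2.2) (.act (pushR symbol))

theorem runsTo_rewind (l : List (A ⊕ C)) : ∀ c : Conf ι σ A C A₀ C₀, c.l = l →
    RunsTo rewind c (2 * l.length + 1) { c with l := [], r := l.reverse ++ c.r } := by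
  induction l with
  | nil =>
    intro c h
    refine .of_halt fun y => ⟨none, ?_⟩
    rw [run_popL, h]
    rfl
  | cons a l ih =>
    intro c h
    have h1 := fun y : Option (A ⊕ C) × Bool =>
      run_popL (c := c) (v := (c.s, y)) (f := fun v o => (v.1, o, o.isSome))
    rw [h] at h1
    have h2 := Runs.act (pushR symbol) ((c.s, some a, true), { c with l := l }.stk)
    rw [run_pushR] at h2
    have := RunsTo.of_cont (c := c) (d := { c with l := l })
      (c' := { c with l := l, r := a :: c.r }) (fun y => ⟨some a, h1 y, _, h2⟩) (ih _ rfl)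
    simp only [List.reverse_cons, List.append_assoc, List.singleton_append]
    exact this.mono (by simp; omega)

end Moves

/-! ### Arrays written as words, and moving to an entry -/

section Store

variable {σ A C : Type}

/-- The word for a row with head `x.1` and cells `x.2`. -/
def rowWord (x : A × List C) : List (A ⊕ C) := Sum.inl x.1 :: x.2.map Sum.inr

theorem isCell_head?_flatMap_rowWord (rs : List (A × List C)) {r : List (A ⊕ C)}
    (hr : isCell r.head? = false) : isCell (rs.flatMap rowWord ++ r).head? = false := by
  cases rs with
  | nil => simpa using hr
  | cons x rs => rfl

/-- State and array of an array program. -/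
structure Store (σ A C : Type) where
  /-- the state -/
  s : σ
  /-- the heads of the rows -/
  hd : ℕ → A
  /-- the cells -/
  cl : ℕ → ℕ → C

/-- The word for the row `i` of an array with `n` columns. -/
def Store.row (n : ℕ) (st : Store σ A C) (i : ℕ) : List (A ⊕ C) :=
  rowWord (st.hd i, (List.range n).map (st.cl i))

/-- The word for an array with `n` rows and `n` columns. -/
def Store.word (n : ℕ) (st : Store σ A C) : List (A ⊕ C) := (List.range n).flatMap (st.row n)

theorem range_eq_append {i n : ℕ} (h : i < n) :
    List.range n = List.range i ++ i :: List.range' (i + 1) (n - (i + 1)) := by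
  rw [List.range_eq_range', List.range_eq_range', ← List.range'_succ]
  have := List.range'_append_1 (s := 0) (m := i) (n := n - (i + 1) + 1)
  rw [zero_add] at this
  rw [this]
  congr 1
  omega

theorem length_word (n : ℕ) (st : Store σ A C) : (st.word n).length = n * (n + 1) := by
  simp [Store.word, Store.row, rowWord, List.length_flatMap]

theorem Store.word_eq {n v : ℕ} (hv : v < n) (st : Store σ A C) :
    st.word n = (List.range v).flatMap (st.row n) ++
      (st.row n v ++ (List.range' (v + 1) (n - (v + 1))).flatMap (st.row n)) := by
  rw [Store.word, range_eq_append hv, List.flatMap_append, List.flatMap_cons]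

/-- The word of an array in which only the row `v` has changed. -/
theorem Store.word_eq_of_row {n v : ℕ} (hv : v < n) {st st' : Store σ A C}
    (h : ∀ j, j ≠ v → st'.row n j = st.row n j) :
    st'.word n = (List.range v).flatMap (st.row n) ++
      (st'.row n v ++ (List.range' (v + 1) (n - (v + 1))).flatMap (st.row n)) := by
  rw [Store.word_eq hv]
  congr 1
  · refine List.flatMap_congr fun j hj => h j ?_
    have := List.mem_range.1 hj; omega
  · congr 1
    refine List.flatMap_congr fun j hj => h j ?_
    have := List.mem_range'_1.1 hj; omega

end Store

variable {ι σ A C A₀ C₀ : Type} [DecidableEq ι] [Inhabited A]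

theorem update_restore {u : Counter ι → ℕ} {w : Counter ι} (hw : w ≠ .tmp) (h : u .tmp = 0) :
    Function.update (Function.update (Function.update (Function.update u w 0) .tmp (u w)) .tmp 0) w
      (u w) = u := by
  funext z
  by_cases h1 : z = w
  · subst h1; simp
  · by_cases h2 : z = .tmp
    · subst h2; simp [hw.symm, h]
    · simp [h1, h2]

/-- Move `p` as often as the counter `w` says, and restore the counter. -/
def repeatU (w : Counter ι) (p : AProg ι σ A C A₀ C₀) : AProg ι σ A C A₀ C₀ :=
  .seq (loopU w (.seq (.act (pushU .tmp)) p)) (transfer .tmp w)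

/-- The families l and r prescribe the two stacks after each round. The body is assumed to work for
any counters, because these change from round to round: every unit taken from w is saved on the
scratch counter. -/
theorem runsTo_loopU_pushU {p : AProg ι σ A C A₀ C₀} {w : Counter ι} (hw : w ≠ .tmp) {t : ℕ}
    (m : ℕ) : ∀ (l r : ℕ → List (A ⊕ C)) (c : Conf ι σ A C A₀ C₀),
    (∀ j < m, ∀ u, RunsTo p { c with l := l j, r := r j, un := u } t
      { c with l := l (j + 1), r := r (j + 1), un := u }) →
    c.l = l 0 → c.r = r 0 → c.un w = m →
    RunsTo (loopU w (.seq (.act (pushU .tmp)) p)) c (m * (t + 2) + 1)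
      { c with l := l m, r := r m,
               un := Function.update (Function.update c.un w 0) .tmp (c.un .tmp + m) } := by
  induction m with
  | zero =>
    intro l r c _ hl hr hu
    have hu' : Function.update c.un w 0 = c.un := by rw [← hu]; exact Function.update_eq_self w c.un
    rw [hu', add_zero, Function.update_eq_self, ← hl, ← hr]
    exact (runsTo_loopU_zero hu).mono (by omega)
  | succ m ih =>
    intro l r c hp hl hr hu
    let u' := Function.update (Function.update c.un w m) .tmp (c.un .tmp + 1)
    have h1 : RunsTo (.act (pushU .tmp)) (c.set w m) 1 { c with l := l 0, r := r 0, un := u' } := by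
      have := runsTo_pushU .tmp (c.set w m)
      rw [← hl, ← hr]
      simpa [Conf.set, hw.symm, u'] using this
    have h2 := hp 0 (by omega) u'
    have h3 := ih (fun j => l (j + 1)) (fun j => r (j + 1))
      { c with l := l 1, r := r 1, un := u' }
      (fun j hj u => hp (j + 1) (by omega) u) rfl rfl (by simp [u', hw])
    have h4 := runsTo_loopU_succ hu (h1.seq h2) h3
    have h5 : Function.update (Function.update c.un w 0) .tmp (c.un .tmp + (m + 1)) =
        Function.update (Function.update u' w 0) .tmp (u' .tmp + m) := by
      funext z
      simp only [u', Function.update_apply]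
      (split_ifs <;> simp_all); omega
    rw [h5]
    exact h4.mono (by ring_nf; omega)

theorem runsTo_repeatU {p : AProg ι σ A C A₀ C₀} {w : Counter ι} (hw : w ≠ .tmp) {t : ℕ}
    (l r : ℕ → List (A ⊕ C)) (c : Conf ι σ A C A₀ C₀)
    (hp : ∀ j < c.un w, ∀ u, RunsTo p { c with l := l j, r := r j, un := u } t
      { c with l := l (j + 1), r := r (j + 1), un := u })
    (hl : c.l = l 0) (hr : c.r = r 0) (htmp : c.un .tmp = 0) :
    RunsTo (repeatU w p) c (c.un w * (t + 4) + 2) { c with l := l (c.un w), r := r (c.un w) } := by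
  have h1 := runsTo_loopU_pushU hw (c.un w) l r c hp hl hr rfl
  have h2 := runsTo_transfer (hw.symm) (c.un w) _
    (by simp [htmp] : Conf.un { c with l := l (c.un w), r := r (c.un w),
                                       un := Function.update (Function.update c.un w 0) .tmp
                                        (c.un .tmp + c.un w) } .tmp = c.un w)
  have h3 := h1.seq h2
  simp only [Conf.set, htmp, zero_add, Function.update_of_ne hw, Function.update_self] at h3
  rw [update_restore hw htmp] at h3
  exact h3.mono (by ring_nf; omega)

/-- Go to the row whose number is the value of the index variable `i`. -/
def gotoRow (i : ι) : AProg ι σ A C A₀ C₀ := repeatU (.cnt i) (.seq moveRight moveCells)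

/-- Move right as often as the value of the index variable `j` says. -/
def gotoCol (j : ι) : AProg ι σ A C A₀ C₀ := repeatU (.cnt j) moveRight

/-- Change the symbol under the reading position. -/
def modify (g : σ → A ⊕ C → σ × (A ⊕ C)) : AProg ι σ A C A₀ C₀ :=
  .seq (.act (popR fun v o => o.elim v fun x => ((g v.1 x).1, some (g v.1 x).2, v.2.2)))
    (.act (pushR symbol))

theorem runsTo_modify (g : σ → A ⊕ C → σ × (A ⊕ C)) {c : Conf ι σ A C A₀ C₀} {x : A ⊕ C}
    {r : List (A ⊕ C)} (h : c.r = x :: r) :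
    RunsTo (modify g) c 2 { c with s := (g c.s x).1, r := (g c.s x).2 :: r } := by
  intro y
  have h1 := Runs.act (popR fun v o => o.elim v fun x => ((g v.1 x).1, some (g v.1 x).2, v.2.2))
    ((c.s, y), c.stk)
  rw [run_popR, h] at h1
  have h2 := Runs.act (pushR symbol)
    (((g c.s x).1, some (g c.s x).2, y.2), { c with s := (g c.s x).1, r := r }.stk)
  rw [run_pushR] at h2
  exact ⟨_, h1.seq h2⟩

theorem runsTo_gotoRow {n v : ℕ} (hv : v < n) {i : ι} {st : Store σ A C}
    {c : Conf ι σ A C A₀ C₀} (hl : c.l = []) (hr : c.r = st.word n) (htmp : c.un .tmp = 0)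
    (hi : c.un (.cnt i) = v) :
    RunsTo (gotoRow i) c (n * (3 * n + 7) + 2)
      { c with l := ((List.range v).flatMap (st.row n)).reverse,
               r := st.row n v ++ (List.range' (v + 1) (n - (v + 1))).flatMap (st.row n) } := by
  have hsplit : ∀ j < n, (List.range' j (n - j)).flatMap (st.row n) =
      st.row n j ++ (List.range' (j + 1) (n - (j + 1))).flatMap (st.row n) := by
    intro j hj
    rw [show n - j = n - (j + 1) + 1 by omega, List.range'_succ, List.flatMap_cons]
  -- After j rounds the first j rows are on the left stack. A round takes 2 steps for the head and
  -- 3n + 1 for the n cells.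
  have := runsTo_repeatU (p := .seq moveRight moveCells) (w := .cnt i) (by simp)
    (t := 2 + (3 * n + 1))
    (fun j => ((List.range j).flatMap (st.row n)).reverse)
    (fun j => (List.range' j (n - j)).flatMap (st.row n)) c ?_ (by simp [hl])
    (by rw [hr, Store.word, List.range_eq_range']; rfl) htmp
  · rw [hi] at this
    rw [← hsplit v hv]
    refine this.mono ?_
    have := Nat.mul_le_mul_right (3 * n + 7) hv.le
    rw [show 2 + (3 * n + 1) + 4 = 3 * n + 7 by omega]
    omega
  · rw [hi]
    intro j hj u
    have hj' : j < n := hj.trans hv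
    rw [hsplit j hj']
    have h1 := runsTo_moveRight (A₀ := A₀) (C₀ := C₀)
      (c := { c with l := ((List.range j).flatMap (st.row n)).reverse, r := st.row n j ++
        (List.range' (j + 1) (n - (j + 1))).flatMap (st.row n), un := u }) (a := Sum.inl (st.hd j)) rfl
    have h2 := h1.seq (runsTo_moveCells (cs := (List.range n).map (st.cl j))
      (r := (List.range' (j + 1) (n - (j + 1))).flatMap (st.row n)) (by
        cases n - (j + 1) <;> rfl) _ rfl)
    rw [List.length_map, List.length_range] at h2
    convert h2 using 2
    simp [List.range_succ, Store.row, rowWord]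

theorem runsTo_gotoCol {n v : ℕ} (hv : v < n) {j : ι} {g : ℕ → A ⊕ C} {r : List (A ⊕ C)}
    {c : Conf ι σ A C A₀ C₀} (hr : c.r = (List.range n).map g ++ r) (htmp : c.un .tmp = 0)
    (hj : c.un (.cnt j) = v) :
    RunsTo (gotoCol j) c (n * 6 + 2)
      { c with l := ((List.range v).map g).reverse ++ c.l,
               r := g v :: ((List.range' (v + 1) (n - (v + 1))).map g ++ r) } := by
  have hsplit : ∀ j < n, (List.range' j (n - j)).map g ++ r =
      g j :: ((List.range' (j + 1) (n - (j + 1))).map g ++ r) := by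
    intro j hj
    rw [show n - j = n - (j + 1) + 1 by omega, List.range'_succ, List.map_cons, List.cons_append]
  have := runsTo_repeatU (p := moveRight) (w := .cnt j) (by simp) (t := 2)
    (fun j => ((List.range j).map g).reverse ++ c.l)
    (fun j => (List.range' j (n - j)).map g ++ r) c ?_ (by simp)
    (by rw [hr, List.range_eq_range']; rfl) htmp
  · rw [hj] at this
    rw [← hsplit v hv]
    exact this.mono (by omega)
  · rw [hj]
    intro j hj u
    rw [hsplit j (hj.trans hv)]
    have h1 := runsTo_moveRight (A₀ := A₀) (C₀ := C₀)
      (c := { c with l := ((List.range j).map g).reverse ++ c.l, r := g j ::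
        ((List.range' (j + 1) (n - (j + 1))).map g ++ r), un := u }) rfl
    convert h1 using 2
    simp [List.range_succ]

/-! ### Array programs and their compilation -/

/-- Array programs: change the head of row `i`, change the cell `(i, j)`, composition, and a loop
in which the variable `i` runs through the indices of the rows. -/
inductive Cmd (ι σ A C : Type)
  | head (i : ι) (f : σ → A → σ × A) : Cmd ι σ A C
  | cell (i j : ι) (f : σ → C → σ × C) : Cmd ι σ A C
  | seq (p q : Cmd ι σ A C) : Cmd ι σ A C
  | loop (i : ι) (p : Cmd ι σ A C) : Cmd ι σ A C

namespace Cmd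

/-- The effect of an array program on an array of size `n`, with the values `env` of the index
variables. -/
def exec (n : ℕ) : Cmd ι σ A C → (ι → ℕ) → Store σ A C → Store σ A C
  | head i f, env, st =>
    { st with s := (f st.s (st.hd (env i))).1,
              hd := Function.update st.hd (env i) (f st.s (st.hd (env i))).2 }
  | cell i j f, env, st =>
    { st with s := (f st.s (st.cl (env i) (env j))).1,
              cl := Function.update st.cl (env i) (Function.update (st.cl (env i)) (env j)
                (f st.s (st.cl (env i) (env j))).2) }
  | seq p q, env, st => q.exec n env (p.exec n env st)
  | loop i p, env, st =>
    (List.range n).foldl (fun st v => p.exec n (Function.update env i v) st) st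

/-- Only the variables in `T` occur free, and no variable is bound twice. -/
def Scoped : Cmd ι σ A C → Set ι → Prop
  | head i _, T => i ∈ T
  | cell i j _, T => i ∈ T ∧ j ∈ T
  | seq p q, T => p.Scoped T ∧ q.Scoped T
  | loop i p, T => i ∉ T ∧ p.Scoped (insert i T)

/-- A head operation on symbols. -/
def onHead (f : σ → A → σ × A) (s : σ) : A ⊕ C → σ × (A ⊕ C)
  | .inl a => ((f s a).1, .inl (f s a).2)
  | .inr b => (s, .inr b)

/-- A cell operation on symbols. -/
def onCell (f : σ → C → σ × C) (s : σ) : A ⊕ C → σ × (A ⊕ C)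
  | .inl a => (s, .inl a)
  | .inr b => ((f s b).1, .inr (f s b).2)

/-- The stack program for an array program. -/
def compile : Cmd ι σ A C → AProg ι σ A C A₀ C₀
  | head i f => .seq (gotoRow i) (.seq (modify (onHead f)) rewind)
  | cell i j f =>
    .seq (gotoRow i) (.seq moveRight (.seq (gotoCol j) (.seq (modify (onCell f)) rewind)))
  | seq p q => .seq p.compile q.compile
  | loop i p =>
    .seq (loopU (.rem i) (.seq p.compile (.act (pushU (.cnt i))))) (transfer (.cnt i) (.rem i))

open Polynomial in
/-- A bound for the running time. -/
noncomputable def time : Cmd ι σ A C → ℕ[X]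
  | head _ _ => 5 * X ^ 2 + 9 * X + 10
  | cell _ _ _ => 5 * X ^ 2 + 15 * X + 20
  | seq p q => p.time + q.time
  | loop _ p => X * (p.time + 4) + 2

end Cmd

variable {inp : List (A₀ ⊕ C₀)} {out : List Bool} {un : Counter ι → ℕ}

theorem runsTo_head {n : ℕ} {i : ι} (f : σ → A → σ × A) (st : Store σ A C) {env : ι → ℕ}
    (hv : env i < n) (htmp : un .tmp = 0) (hi : un (.cnt i) = env i) :
    RunsTo (Cmd.head i f).compile ⟨st.s, inp, out, [], st.word n, un⟩
      ((Cmd.head i f : Cmd ι σ A C).time.eval n)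
      ⟨((Cmd.head i f).exec n env st).s, inp, out, [],
        ((Cmd.head i f).exec n env st).word n, un⟩ := by
  set v := env i with he
  have h1 := runsTo_gotoRow (c := ⟨st.s, inp, out, [], st.word n, un⟩) hv rfl rfl htmp hi
  have h2 : RunsTo (modify (Cmd.onHead f))
      (⟨st.s, inp, out, ((List.range v).flatMap (st.row n)).reverse,
        st.row n v ++ (List.range' (v + 1) (n - (v + 1))).flatMap (st.row n), un⟩ :
          Conf ι σ A C A₀ C₀) 2
      (⟨((Cmd.head i f).exec n env st).s, inp, out, ((List.range v).flatMap (st.row n)).reverse,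
        ((Cmd.head i f).exec n env st).row n v ++
          (List.range' (v + 1) (n - (v + 1))).flatMap (st.row n), un⟩ : Conf ι σ A C A₀ C₀) := by
    have := runsTo_modify (Cmd.onHead f) (x := Sum.inl (st.hd v))
      (r := ((List.range n).map (st.cl v)).map Sum.inr ++
        (List.range' (v + 1) (n - (v + 1))).flatMap (st.row n))
      (c := ⟨st.s, inp, out, ((List.range v).flatMap (st.row n)).reverse,
        st.row n v ++ (List.range' (v + 1) (n - (v + 1))).flatMap (st.row n), un⟩) rfl
    simpa [Cmd.onHead, Cmd.exec, Store.row, rowWord, ← he] using this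
  have h3 := runsTo_rewind _
    (⟨((Cmd.head i f).exec n env st).s, inp, out, ((List.range v).flatMap (st.row n)).reverse,
        ((Cmd.head i f).exec n env st).row n v ++
          (List.range' (v + 1) (n - (v + 1))).flatMap (st.row n), un⟩ : Conf ι σ A C A₀ C₀) rfl
  have hlen : ((List.range v).flatMap (st.row n)).reverse.length ≤ n * (n + 1) := by
    rw [← length_word n st, Store.word_eq hv]
    simp
  rw [Store.word_eq_of_row hv (st' := (Cmd.head i f).exec n env st) (st := st)
    (fun j hj => by simp [Store.row, Cmd.exec, ← he, hj])]
  simp only [List.reverse_reverse] at h3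
  refine (h1.seq (h2.seq h3)).mono ?_
  simp only [Cmd.time, Polynomial.eval_add, Polynomial.eval_mul, Polynomial.eval_pow,
    Polynomial.eval_X, Polynomial.eval_ofNat]
  nlinarith

theorem runsTo_cell {n : ℕ} {i j : ι} (f : σ → C → σ × C) (st : Store σ A C) {env : ι → ℕ}
    (hv : env i < n) (hw : env j < n) (htmp : un .tmp = 0) (hi : un (.cnt i) = env i)
    (hj : un (.cnt j) = env j) :
    RunsTo (Cmd.cell i j f).compile ⟨st.s, inp, out, [], st.word n, un⟩
      ((Cmd.cell i j f : Cmd ι σ A C).time.eval n)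
      ⟨((Cmd.cell i j f).exec n env st).s, inp, out, [],
        ((Cmd.cell i j f).exec n env st).word n, un⟩ := by
  set v := env i with he
  set w := env j with he'
  set st' := (Cmd.cell i j f).exec n env st with hst'
  let g : ℕ → A ⊕ C := fun u => Sum.inr (st.cl v u)
  let l₁ := ((List.range v).flatMap (st.row n)).reverse
  let r₁ := (List.range' (v + 1) (n - (v + 1))).flatMap (st.row n)
  let l₂ := ((List.range w).map g).reverse ++ Sum.inl (st.hd v) :: l₁
  let r₂ := (List.range' (w + 1) (n - (w + 1))).map g ++ r₁
  have h1 := runsTo_gotoRow (c := ⟨st.s, inp, out, [], st.word n, un⟩) hv rfl rfl htmp hi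
  have h2 : RunsTo moveRight (⟨st.s, inp, out, l₁, st.row n v ++ r₁, un⟩ : Conf ι σ A C A₀ C₀) 2
      ⟨st.s, inp, out, Sum.inl (st.hd v) :: l₁, (List.range n).map g ++ r₁, un⟩ :=
    runsTo_moveRight (by simp [Store.row, rowWord, g])
  have h3 : RunsTo (gotoCol j) _ (n * 6 + 2)
      (⟨st.s, inp, out, l₂, g w :: r₂, un⟩ : Conf ι σ A C A₀ C₀) :=
    runsTo_gotoCol (c := ⟨st.s, inp, out, Sum.inl (st.hd v) :: l₁, (List.range n).map g ++ r₁, un⟩)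
      hw rfl htmp hj
  have h4 : RunsTo (modify (Cmd.onCell f))
      (⟨st.s, inp, out, l₂, g w :: r₂, un⟩ : Conf ι σ A C A₀ C₀) 2
      (⟨st'.s, inp, out, l₂, Sum.inr (st'.cl v w) :: r₂, un⟩ : Conf ι σ A C A₀ C₀) := by
    have := runsTo_modify (Cmd.onCell f) (x := g w) (r := r₂)
      (c := ⟨st.s, inp, out, l₂, g w :: r₂, un⟩) rfl
    simpa [Cmd.onCell, hst', Cmd.exec, g, ← he, ← he'] using this
  have h5 := runsTo_rewind _
    (⟨st'.s, inp, out, l₂, Sum.inr (st'.cl v w) :: r₂, un⟩ : Conf ι σ A C A₀ C₀) rfl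
  have hrow : st.row n v = Sum.inl (st.hd v) :: ((List.range w).map g ++
      g w :: (List.range' (w + 1) (n - (w + 1))).map g) := by
    rw [Store.row, range_eq_append hw]
    simp [rowWord, g, Function.comp_def]
  have hrow' : st'.row n v = Sum.inl (st.hd v) :: ((List.range w).map g ++
      Sum.inr (st'.cl v w) :: (List.range' (w + 1) (n - (w + 1))).map g) := by
    have hcl : ∀ u, u ≠ w → st'.cl v u = st.cl v u := fun u hu => by
      simp [hst', Cmd.exec, ← he, ← he', hu]
    rw [Store.row, range_eq_append hw]
    simp only [rowWord, List.map_append, List.map_cons, List.map_map]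
    congr 1
    congr 1
    · refine List.map_congr_left fun u hu => ?_
      have := List.mem_range.1 hu
      exact congrArg Sum.inr (hcl u (by omega))
    · congr 1
      refine List.map_congr_left fun u hu => ?_
      have := List.mem_range'_1.1 hu
      exact congrArg Sum.inr (hcl u (by omega))
  have hlen : l₂.length ≤ n * (n + 1) := by
    rw [← length_word n st, Store.word_eq hv, hrow]
    simp [l₂, l₁]
    omega
  rw [Store.word_eq_of_row hv (st' := st') (st := st)
    (fun j hj => by simp [hst', Store.row, Cmd.exec, ← he, hj]), hrow']
  have hr : l₂.reverse ++ Sum.inr (st'.cl v w) :: r₂ = (List.range v).flatMap (st.row n) ++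
      (Sum.inl (st.hd v) :: ((List.range w).map g ++
      Sum.inr (st'.cl v w) :: (List.range' (w + 1) (n - (w + 1))).map g) ++ r₁) := by
    simp [l₂, l₁, r₂]
  simp only [hr] at h5
  refine (h1.seq (h2.seq (h3.seq (h4.seq h5)))).mono ?_
  simp only [Cmd.time, Polynomial.eval_add, Polynomial.eval_mul, Polynomial.eval_pow,
    Polynomial.eval_X, Polynomial.eval_ofNat]
  nlinarith

variable {ι σ A C A₀ C₀ : Type} [DecidableEq ι] [Inhabited A]

/-- The invariant between commands: the whole array is on the right stack, the scratch counter is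
empty, the counters of the variables in T hold their values, and every other variable has value 0
and all n rounds ahead. Each command restores the counters, so the invariant survives composition
and the rounds of a loop. -/
theorem runsTo_compile {n : ℕ} {inp : List (A₀ ⊕ C₀)} {out : List Bool} (c : Cmd ι σ A C) :
    ∀ (T : Set ι) (env : ι → ℕ) (un : Counter ι → ℕ) (st : Store σ A C), c.Scoped T →
      un .tmp = 0 → (∀ i ∈ T, env i < n ∧ un (.cnt i) = env i) →
      (∀ i ∉ T, un (.cnt i) = 0 ∧ un (.rem i) = n) →
      RunsTo c.compile ⟨st.s, inp, out, [], st.word n, un⟩ (c.time.eval n)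
        ⟨(c.exec n env st).s, inp, out, [], (c.exec n env st).word n, un⟩ := by
  induction c with
  | head i f =>
    intro T env un st hc htmp hT _
    exact runsTo_head f st (hT i hc).1 htmp (hT i hc).2
  | cell i j f =>
    intro T env un st hc htmp hT _
    exact runsTo_cell f st (hT i hc.1).1 (hT j hc.2).1 htmp (hT i hc.1).2 (hT j hc.2).2
  | seq p q ihp ihq =>
    intro T env un st hc htmp hT hT'
    rw [Cmd.time, Polynomial.eval_add]
    exact (ihp T env un st hc.1 htmp hT hT').seq (ihq T env un _ hc.2 htmp hT hT')
  | loop i p ih =>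
    intro T env un st hc htmp hT hT'
    -- The rounds done and the rounds left always add up to n, so v is both the number of finished
    -- rounds and the current index.
    have hloop : ∀ (m v : ℕ) (st : Store σ A C), v + m = n →
        RunsTo (loopU (.rem i) (.seq p.compile (.act (pushU (.cnt i)))))
          (⟨st.s, inp, out, [], st.word n,
            Function.update (Function.update un (.cnt i) v) (.rem i) m⟩ : Conf ι σ A C A₀ C₀)
          (m * (p.time.eval n + 2) + 1)
          ⟨((List.range' v m).foldl
              (fun st v => p.exec n (Function.update env i v) st) st).s, inp, out, [],
            ((List.range' v m).foldl
              (fun st v => p.exec n (Function.update env i v) st) st).word n,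
            Function.update (Function.update un (.cnt i) n) (.rem i) 0⟩ := by
      intro m
      induction m with
      | zero =>
        intro v st hv
        obtain rfl : v = n := by omega
        exact (runsTo_loopU_zero (by simp)).mono (by omega)
      | succ m ihm =>
        intro v st hv
        have h1 := ih (insert i T) (Function.update env i v)
          (Function.update (Function.update un (.cnt i) v) (.rem i) m) st hc.2 (by simp [htmp])
          (fun j hj => by
            by_cases hji : j = i
            · subst hji; simp; omega
            · simpa [hji] using hT j (hj.resolve_left hji))
          (fun j hj => by
            have hji : j ≠ i := fun h => hj (Or.inl h)
            simpa [hji] using hT' j (fun h => hj (Or.inr h)))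
        have h2 := h1.seq (runsTo_pushU (.cnt i) _)
        have h3 := ihm (v + 1) (p.exec n (Function.update env i v) st) (by omega)
        have hun : Function.update (Function.update (Function.update un (.cnt i) v) (.rem i) m)
            (.cnt i) (v + 1) =
            Function.update (Function.update un (.cnt i) (v + 1)) (.rem i) m := by
          rw [Function.update_comm (by simp), Function.update_idem]
        rw [List.range'_succ, List.foldl_cons]
        refine (runsTo_loopU_succ (n := m) (by simp) ?_ h3).mono
          (t := 1 + (p.time.eval n + 1) + (m * (p.time.eval n + 2) + 1)) (by ring_nf; omega)
        rw [← hun]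
        simpa [Conf.set] using h2
    have hi := hT' i hc.1
    have h1 := hloop n 0 st (by omega)
    have h0 : Function.update (Function.update un (.cnt i) 0) (.rem i) n = un := by
      conv_lhs => rw [← hi.1]
      rw [Function.update_eq_self]
      conv_lhs => rw [← hi.2]
      rw [Function.update_eq_self]
    rw [h0, ← List.range_eq_range'] at h1
    -- Moving the n units back makes the loop ready for another use.
    have h2 := h1.seq (runsTo_transfer (u := .cnt i) (w := .rem i) (by simp) n _ (by simp))
    have h3 : Function.update (Function.update (Function.update (Function.update un (.cnt i) n)
        (.rem i) 0) (.cnt i) 0) (.rem i) (0 + n) = un := by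
      rw [zero_add, Function.update_comm (a := Counter.rem i) (by simp), Function.update_idem,
        Function.update_idem, h0]
    simp only [Conf.set, Function.update_self] at h2
    rw [h3] at h2
    refine h2.mono ?_
    simp only [Cmd.time, Polynomial.eval_add, Polynomial.eval_mul, Polynomial.eval_X,
      Polynomial.eval_ofNat]
    ring_nf
    omega

/-! ### Reading the input, clearing the stacks and writing the answer -/

/-- Do nothing. -/
def skip : AProg ι σ A C A₀ C₀ := .act (.load id)

theorem runsTo_skip (c : Conf ι σ A C A₀ C₀) : RunsTo skip c 1 c := .of_act fun y => ⟨y, rfl⟩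

/-- Add a unit to the loop counters of all variables in the list. -/
def pushAll : List ι → AProg ι σ A C A₀ C₀
  | [] => skip
  | i :: is => .seq (.act (pushU (.rem i))) (pushAll is)

theorem runsTo_pushAll (is : List ι) : ∀ c : Conf ι σ A C A₀ C₀,
    RunsTo (pushAll is) c (is.length + 1)
      { c with un := fun u => c.un u + (is.map Counter.rem).count u } := by
  induction is with
  | nil => intro c; exact runsTo_skip c
  | cons i is ih =>
    intro c
    have h := (runsTo_pushU (.rem i) c).seq (ih _)
    have hun : (fun u => c.un u + ((i :: is).map Counter.rem).count u) =
        fun u => (c.set (.rem i) (c.un (.rem i) + 1)).un u + (is.map Counter.rem).count u := by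
      funext u
      rw [List.map_cons, List.count_cons]
      by_cases hu : u = .rem i
      · subst hu; simp [Conf.set]; omega
      · simp [Conf.set, hu, Ne.symm hu]
    rw [hun]
    exact h.mono (by simp; omega)

/-- Empty the loop counters of all variables in the list. -/
def drainAll : List ι → AProg ι σ A C A₀ C₀
  | [] => skip
  | i :: is => .seq (loopU (.rem i) skip) (drainAll is)

theorem runsTo_drain (u : Counter ι) (n : ℕ) : ∀ c : Conf ι σ A C A₀ C₀, c.un u = n →
    RunsTo (loopU u skip) c (2 * n + 1) (c.set u 0) := by
  induction n with
  | zero => intro c h; rw [Conf.set_self h]; exact runsTo_loopU_zero h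
  | succ n ih =>
    intro c h
    have := runsTo_loopU_succ h (runsTo_skip _) (ih (c.set u n) (by simp [Conf.set]))
    simp only [Conf.set, Function.update_idem] at this ⊢
    exact this.mono (by omega)

theorem runsTo_drainAll {n : ℕ} (is : List ι) : ∀ c : Conf ι σ A C A₀ C₀, (∀ u, c.un u ≤ n) →
    RunsTo (drainAll is) c (is.length * (2 * n + 1) + 1)
      { c with un := fun u => if u ∈ is.map Counter.rem then 0 else c.un u } := by
  induction is with
  | nil =>
    intro c _
    simp only [List.map_nil, List.not_mem_nil, if_false]
    exact (runsTo_skip c).mono (by simp)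
  | cons i is ih =>
    intro c hc
    have h := (runsTo_drain (.rem i) _ c rfl).seq (ih _ (fun u => by
      by_cases hu : u = .rem i
      · subst hu; simp [Conf.set]
      · simpa [Conf.set, hu] using hc u))
    have hun : (fun u => if u ∈ (i :: is).map Counter.rem then 0 else c.un u) =
        fun u => if u ∈ is.map Counter.rem then 0 else (c.set (.rem i) 0).un u := by
      funext u
      by_cases hu : u = .rem i
      · subst hu; simp [Conf.set]
      · simp only [List.map_cons, List.mem_cons, hu, false_or]
        simp [Conf.set, hu]
    rw [hun]
    have := hc (.rem i)
    exact h.mono (by simp; ring_nf; omega)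

/-- Empty the right stack. -/
def drainR : AProg ι σ A C A₀ C₀ :=
  .loop (popR fun v o => (v.1, none, o.isSome)) (fun v => v.2.2) skip

theorem runsTo_drainR (r : List (A ⊕ C)) : ∀ c : Conf ι σ A C A₀ C₀, c.r = r →
    RunsTo drainR c (2 * r.length + 1) { c with r := [] } := by
  induction r with
  | nil =>
    intro c h
    exact .of_halt fun y => ⟨none, by rw [run_popR, h]; rfl⟩
  | cons a r ih =>
    intro c h
    have h1 := fun y : Option (A ⊕ C) × Bool =>
      run_popR (c := c) (v := (c.s, y)) (f := fun v o => (v.1, none, o.isSome))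
    rw [h] at h1
    have := RunsTo.of_cont' (c := c) (d := { c with r := r }) (fun y => ⟨none, h1 y⟩)
      (runsTo_skip _) (ih _ rfl)
    exact this.mono (by simp; omega)

variable (cA : A₀ → A) (cC : C₀ → C)

/-- Read the cells of a row of the input. -/
def readCells : AProg ι σ A C A₀ C₀ :=
  .loop (peekI fun v o => (v.1, v.2.1, isCell o)) (fun v => v.2.2)
    (.seq (.act (popI fun v o => (v.1, o.map (Sum.map cA cC), v.2.2))) (.act (pushL symbol)))

theorem runsTo_readCells {w : List (A₀ ⊕ C₀)} (hw : isCell w.head? = false) (cs : List C₀) :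
    ∀ c : Conf ι σ A C A₀ C₀, c.inp = cs.map Sum.inr ++ w →
      RunsTo (readCells cA cC) c (3 * cs.length + 1)
        { c with inp := w, l := ((cs.map Sum.inr).map (Sum.map cA cC)).reverse ++ c.l } := by
  induction cs with
  | nil =>
    intro c h
    refine .of_halt fun y => ⟨y.1, ?_⟩
    rw [run_peekI, h]
    have hc : c = { c with inp := w } := by cases c; simp_all
    simp only [List.map_nil, List.nil_append, hw, List.reverse_nil]
    rw [← hc]
  | cons b cs ih =>
    intro c h
    have hbody : RunsTo (.seq (.act (popI fun v o => (v.1, o.map (Sum.map cA cC), v.2.2)))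
        (.act (pushL symbol))) c 2
        { c with inp := cs.map Sum.inr ++ w, l := Sum.inr (cC b) :: c.l } := by
      intro y
      have h1 := Runs.act (popI fun v o => (v.1, o.map (Sum.map cA cC), v.2.2)) ((c.s, y), c.stk)
      rw [run_popI, h] at h1
      have h2 := Runs.act (pushL symbol)
        ((c.s, some (Sum.inr (cC b)), y.2), { c with inp := cs.map Sum.inr ++ w }.stk)
      rw [run_pushL] at h2
      exact ⟨_, h1.seq h2⟩
    have := RunsTo.of_cont' (c := c) (d := c) (fun y => ⟨y.1, by rw [run_peekI, h]; rfl⟩)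
      hbody (ih _ rfl)
    simp only [List.map_cons, List.reverse_cons, List.append_assoc, List.singleton_append,
      Sum.map_inr]
    exact this.mono (by simp; omega)

/-- Read the input and count its rows. -/
def readInput (is : List ι) : AProg ι σ A C A₀ C₀ :=
  .loop (popI fun v o => (v.1, o.map (Sum.map cA cC), o.isSome)) (fun v => v.2.2)
    (.seq (.act (pushL symbol)) (.seq (pushAll is) (readCells cA cC)))

theorem runsTo_readInput {n : ℕ} (is : List ι) (rs : List (A₀ × List C₀)) :
    (∀ x ∈ rs, x.2.length = n) → ∀ c : Conf ι σ A C A₀ C₀, c.inp = rs.flatMap rowWord →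
      RunsTo (readInput cA cC is) c (rs.length * (3 * n + is.length + 4) + 1)
        { c with inp := [], l := ((rs.flatMap rowWord).map (Sum.map cA cC)).reverse ++ c.l,
                 un := fun u => c.un u + rs.length * (is.map Counter.rem).count u } := by
  induction rs with
  | nil =>
    intro _ c h
    have h1 : ∀ y : Option (A ⊕ C) × Bool,
        (popI fun v o => (v.1, o.map (Sum.map cA cC), o.isSome) : AAct ι σ A C A₀ C₀).run
          ((c.s, y), c.stk) =
          ((c.s, none, false), { c with inp := [] }.stk) := fun y => by
      rw [run_popI, h]; rfl
    have h2 := RunsTo.of_halt (c := c) (c' := { c with inp := [] })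
      (p := .seq (.act (pushL symbol)) (.seq (pushAll is) (readCells cA cC)))
      fun y => ⟨none, h1 y⟩
    simpa [readInput] using h2
  | cons x rs ih =>
    intro hn c h
    obtain ⟨a, cs⟩ := x
    have hcs : cs.length = n := hn (a, cs) (by simp)
    have hw : isCell (rs.flatMap rowWord).head? = false := by
      simpa using isCell_head?_flatMap_rowWord rs (r := []) rfl
    let d : Conf ι σ A C A₀ C₀ := { c with inp := cs.map Sum.inr ++ rs.flatMap rowWord }
    let d' : Conf ι σ A C A₀ C₀ := { d with l := Sum.inl (cA a) :: c.l }
    have h1 : ∀ y : Option (A ⊕ C) × Bool,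
        (popI fun v o => (v.1, o.map (Sum.map cA cC), o.isSome) : AAct ι σ A C A₀ C₀).run
          ((c.s, y), c.stk) =
          ((d.s, some (Sum.inl (cA a)), true), d.stk) := fun y => by
      rw [run_popI, h]; rfl
    have h2 : Runs (.act (pushL symbol)) ((d.s, some (Sum.inl (cA a)), true), d.stk) 1
        ((d'.s, some (Sum.inl (cA a)), true), d'.stk) := by
      have := Runs.act (pushL symbol) ((d.s, some (Sum.inl (cA a)), true), d.stk)
      rw [run_pushL] at this
      exact this
    have h3 := (runsTo_pushAll is d').seq (runsTo_readCells cA cC hw cs _ rfl)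
    have h4 := ih (fun x hx => hn x (by simp [hx])) (⟨c.s, rs.flatMap rowWord, c.out,
      ((cs.map Sum.inr).map (Sum.map cA cC)).reverse ++ Sum.inl (cA a) :: c.l, c.r,
      fun u => c.un u + (is.map Counter.rem).count u⟩) rfl
    have h5 := RunsTo.of_cont (fun y => ⟨_, h1 y, by
      obtain ⟨y', h3⟩ := h3 (some (Sum.inl (cA a)), true)
      exact ⟨y', h2.seq h3⟩⟩) h4
    have hl : ((((a, cs) :: rs).flatMap rowWord).map (Sum.map cA cC)).reverse ++ c.l =
        ((rs.flatMap rowWord).map (Sum.map cA cC)).reverse ++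
          (((cs.map Sum.inr).map (Sum.map cA cC)).reverse ++ Sum.inl (cA a) :: c.l) := by
      simp [rowWord]
    have hun : (fun u => c.un u + ((a, cs) :: rs).length * (is.map Counter.rem).count u) =
        fun u => c.un u + (is.map Counter.rem).count u +
          rs.length * (is.map Counter.rem).count u := by
      funext u
      rw [List.length_cons]
      ring
    rw [hl, hun]
    refine h5.mono ?_
    rw [hcs, List.length_cons]
    ring_nf
    omega

/-- The whole program: read the input, run the array program, clear the stacks, and write the
answer. -/
def mainProg (is : List ι) (c : Cmd ι σ A C) (g : σ → Bool) : AProg ι σ A C A₀ C₀ :=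
  .seq (readInput cA cC is) (.seq rewind (.seq c.compile
    (.seq drainR (.seq (drainAll is) (.act (pushO fun v => g v.1))))))

open Polynomial in
/-- A bound for the running time of the whole program, with `m` index variables. -/
noncomputable def mainTime (m : ℕ) (c : Cmd ι σ A C) : ℕ[X] :=
  X * (3 * X + (m : ℕ[X]) + 4) + 1 + ((2 * (X * (X + 1)) + 1) + (c.time +
    ((2 * (X * (X + 1)) + 1) + (((m : ℕ[X]) * (2 * X + 1) + 1) + 1))))

theorem runsTo_mainProg {n : ℕ} {is : List ι} (his : is.Nodup) (his' : ∀ i, i ∈ is)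
    {c : Cmd ι σ A C} (hc : c.Scoped ∅) (g : σ → Bool) (st₀ : Store σ A₀ C₀)
    (st : Store σ A C) (hhd : ∀ i, st.hd i = cA (st₀.hd i))
    (hcl : ∀ i j, st.cl i j = cC (st₀.cl i j)) :
    RunsTo (mainProg cA cC is c g)
      (⟨st.s, st₀.word n, [], [], [], fun _ => 0⟩ : Conf ι σ A C A₀ C₀)
      ((mainTime is.length c).eval n)
      ⟨(c.exec n (fun _ => 0) st).s, [], [g (c.exec n (fun _ => 0) st).s], [], [], fun _ => 0⟩ := by
  -- Reading adds one unit per row to every loop counter, so each ends at n and all other counters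
  -- stay at 0.
  let un : Counter ι → ℕ := fun u => n * (is.map Counter.rem).count u
  have hcount : ∀ i, (is.map Counter.rem).count (Counter.rem i) = 1 := fun i =>
    List.count_eq_one_of_mem (his.map (fun _ _ h => by simpa using h))
      (List.mem_map_of_mem (his' i))
  have hcount' : ∀ u : Counter ι, (∀ i, u ≠ .rem i) → (is.map Counter.rem).count u = 0 :=
    fun u hu => List.count_eq_zero_of_not_mem (by simpa using fun i _ => (hu i).symm)
  have hword : (st₀.word n).map (Sum.map cA cC) = st.word n := by
    simp only [Store.word, List.map_flatMap]
    refine List.flatMap_congr fun i _ => ?_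
    simp [Store.row, rowWord, hhd, hcl]
  have h1 := runsTo_readInput cA cC (n := n) is
    ((List.range n).map fun i => (st₀.hd i, (List.range n).map (st₀.cl i)))
    (by simp) (⟨st.s, st₀.word n, [], [], [], fun _ => 0⟩ : Conf ι σ A C A₀ C₀)
    (by simp [Store.word, List.flatMap_map]; rfl)
  have hw : ((List.range n).map fun i => (st₀.hd i, (List.range n).map (st₀.cl i))).flatMap
      rowWord = st₀.word n := by
    simp [Store.word, List.flatMap_map]; rfl
  rw [hw, hword, List.length_map, List.length_range, List.append_nil] at h1
  simp only [zero_add] at h1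
  have h2 := runsTo_rewind _ (⟨st.s, [], [], (st.word n).reverse, [], un⟩ : Conf ι σ A C A₀ C₀) rfl
  simp only [List.reverse_reverse, List.append_nil, List.length_reverse, length_word] at h2
  have h3 := runsTo_compile (n := n) (inp := ([] : List (A₀ ⊕ C₀))) (out := []) c ∅ (fun _ => 0) un st hc
    (by simp [un, hcount']) (by simp) (fun i _ => ⟨by simp [un, hcount'], by simp [un, hcount]⟩)
  have h4 := runsTo_drainR _ (⟨(c.exec n (fun _ => 0) st).s, [], [], [],
    (c.exec n (fun _ => 0) st).word n, un⟩ : Conf ι σ A C A₀ C₀) rfl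
  simp only [length_word] at h4
  have h5 := runsTo_drainAll (n := n) is (⟨(c.exec n (fun _ => 0) st).s, [], [], [],
    [], un⟩ : Conf ι σ A C A₀ C₀) (fun u => by
      by_cases hu : ∃ i, u = .rem i
      · obtain ⟨i, rfl⟩ := hu; simp [un, hcount]
      · push Not at hu; simp [un, hcount' u hu])
  have hun : (fun u => if u ∈ is.map Counter.rem then 0 else un u) = fun _ => 0 := by
    funext u
    split_ifs with hu
    · rfl
    · simp [un, List.count_eq_zero_of_not_mem hu]
  simp only [hun] at h5
  have h6 : RunsTo (.act (pushO fun v => g v.1)) (⟨(c.exec n (fun _ => 0) st).s, [], [], [],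
      [], fun _ => 0⟩ : Conf ι σ A C A₀ C₀) 1 ⟨(c.exec n (fun _ => 0) st).s, [],
        [g (c.exec n (fun _ => 0) st).s], [], [], fun _ => 0⟩ :=
    .of_act fun y => ⟨y, by rw [run_pushO]⟩
  refine (h1.seq (h2.seq (h3.seq (h4.seq (h5.seq h6))))).mono ?_
  simp [mainTime]

theorem eval_mono {p : Polynomial ℕ} {m n : ℕ} (h : m ≤ n) : p.eval m ≤ p.eval n := by
  rw [Polynomial.eval_eq_sum, Polynomial.eval_eq_sum]
  exact Finset.sum_le_sum fun i _ => Nat.mul_le_mul_left _ (Nat.pow_le_pow_left h i)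

/-- A decision problem that an array program solves is decided in polynomial time: the instance `a`
is encoded as an array of size `n a` with heads and cells `st₀ a`. -/
theorem polyTime_of_cmd [Finite ι] [Finite σ] [Finite A] [Finite C] [Finite A₀] [Finite C₀]
    {α : Type} (enc : α → List (A₀ ⊕ C₀)) (ans : α → Bool) (n : α → ℕ) (s₀ : σ)
    (hd : α → ℕ → A₀) (cl : α → ℕ → ℕ → C₀)
    (henc : ∀ a, enc a = (⟨s₀, hd a, cl a⟩ : Store σ A₀ C₀).word (n a))
    (c : Cmd ι σ A C) (hc : c.Scoped ∅) (g : σ → Bool)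
    (hans : ∀ a, g (c.exec (n a) (fun _ => 0)
      ⟨s₀, fun i => cA (hd a i), fun i j => cC (cl a i j)⟩).s = ans a) :
    Nonempty (TM2ComputableInPolyTime enc Computability.encodeBool ans) := by
  have : Fintype ι := Fintype.ofFinite ι
  have : Fintype (Stk ι) := Fintype.ofFinite _
  have : Fintype (Reg σ A C) := Fintype.ofFinite _
  have : Fintype (Alph ι A C A₀ C₀ .inp) := Fintype.ofFinite (A₀ ⊕ C₀)
  let is : List ι := Finset.univ.toList
  let v₀ : Reg σ A C := (s₀, none, false)
  let p : AProg ι σ A C A₀ C₀ := mainProg cA cC is c g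
  refine ⟨{ tm := p.machine .inp .out v₀
            inputAlphabet := Equiv.refl (A₀ ⊕ C₀)
            outputAlphabet := Equiv.refl Bool
            time := mainTime is.length c + 1
            outputsFun := fun a => Classical.choice ?_ }⟩
  have hrun := runsTo_mainProg cA cC (n := n a) (is := is) (Finset.nodup_toList _)
    (fun i => by simp [is]) hc g ⟨s₀, hd a, cl a⟩
    ⟨s₀, fun i => cA (hd a i), fun i j => cC (cl a i j)⟩ (fun _ => rfl) (fun _ _ => rfl)
    (none, false)
  obtain ⟨y, hrun⟩ := hrun
  rw [← henc a, hans a] at hrun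
  have hlen : (enc a).length = n a * (n a + 1) := by rw [henc, length_word]
  -- The bound in n is also a bound in the input length n(n + 1), which is at least n; the extra 1
  -- is the halting step.
  have hle : (mainTime is.length c).eval (n a) + 1 ≤
      (mainTime is.length c + 1).eval (enc a).length := by
    rw [Polynomial.eval_add, Polynomial.eval_one, hlen]
    exact Nat.add_le_add_right (eval_mono (Nat.le_mul_of_pos_right _ (by omega))) 1
  obtain ⟨h⟩ := Runs.evalsToInTime (p := p) (k₀ := .inp) (k₁ := .out) (v₀ := v₀)
    (w := enc a) (w' := [ans a]) (t := (mainTime is.length c).eval (n a))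
    (s := ((_, y), Conf.stk ⟨_, [], [ans a], [], [], fun _ => 0⟩))
    (by
      convert hrun using 2
      refine Prod.ext rfl ?_
      funext k
      cases k <;> rfl)
    (by
      funext k
      cases k <;> rfl)
  have hmap : List.map (Equiv.refl (A₀ ⊕ C₀)).invFun (enc a) = enc a := List.map_id _
  refine ⟨⟨⟨h.steps, ?_⟩, h.steps_le_m.trans hle⟩⟩
  exact (congrArg (fun w : List (A₀ ⊕ C₀) => (flip bind (p.machine .inp .out v₀).step)^[h.steps]
    (some (initList (p.machine .inp .out v₀) w))) hmap).trans h.evals_in_steps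

end ArrayProg

/-! ### Constraint propagation as an array program -/

namespace PrecolouringInstance

open ArrayProg

section Program

variable {k : ℕ}

/-- The state of the array program: the relations between the vertices of the current tuple, a
precolour, and the answer. -/
structure LocalState (k : ℕ) where
  /-- the relations on the current tuple -/
  rel : Fin (k + 2) → Fin (k + 2) → Fin k → Fin k → Bool
  /-- the precolour of the first vertex of the current tuple -/
  pre : Option (Fin k)
  /-- the answer -/
  ans : Bool

instance : Finite (LocalState k) :=
  Finite.of_injective (fun s : LocalState k => (s.rel, s.pre, s.ans)) (by
    rintro ⟨⟩ ⟨⟩ h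
    simpa using h)

/-- The index variables: the positions of a tuple, and two counters. -/
abbrev Idx (k : ℕ) : Type := Fin (k + 2) ⊕ Bool

/-- A cell for the pair `u v` holds the adjacency of `u` and `v` and the relation of `u` and `v`. -/
abbrev Cell (k : ℕ) : Type := Bool × (Fin k → Fin k → Bool)

abbrev RelCmd (k : ℕ) : Type := Cmd (Idx k) (LocalState k) (Option (Fin k)) (Cell k)

abbrev RelStore (k : ℕ) : Type := Store (LocalState k) (Option (Fin k)) (Cell k)

/-- The colouring `φ` of `0, …, n - 1` satisfies all constraints of `st`. -/
structure Solves (n : ℕ) (φ : ℕ → Fin k) (st : RelStore k) : Prop where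
  pre : ∀ u < n, ∀ p, st.hd u = some p → φ u = p
  adj : ∀ u < n, ∀ v < n, (st.cl u v).1 = true → φ u ≠ φ v
  rel : ∀ u < n, ∀ v < n, (st.cl u v).2 (φ u) (φ v) = true

/-- `st'` results from `st` by removing pairs from relations, but no solutions. -/
structure Tightens (n : ℕ) (st' st : RelStore k) : Prop where
  hd : st'.hd = st.hd
  adj : ∀ u v, (st'.cl u v).1 = (st.cl u v).1
  rel : ∀ u v a b, (st'.cl u v).2 a b = true → (st.cl u v).2 a b = true
  out : ∀ u v, ¬ (u < n ∧ v < n) → st'.cl u v = st.cl u v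
  solves : ∀ φ, Solves n φ st → Solves n φ st'
  ans : st'.s.ans = st.s.ans

variable {n : ℕ}

theorem Tightens.refl (st : RelStore k) : Tightens n st st :=
  ⟨rfl, fun _ _ => rfl, fun _ _ _ _ h => h, fun _ _ _ => rfl, fun _ h => h, rfl⟩

theorem Tightens.trans {st₁ st₂ st₃ : RelStore k} (h : Tightens n st₁ st₂)
    (h' : Tightens n st₂ st₃) : Tightens n st₁ st₃ :=
  ⟨h.hd.trans h'.hd, fun u v => (h.adj u v).trans (h'.adj u v),
    fun u v a b hr => h'.rel u v a b (h.rel u v a b hr),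
    fun u v ho => (h.out u v ho).trans (h'.out u v ho),
    fun φ hφ => h.solves φ (h'.solves φ hφ), h.ans.trans h'.ans⟩

theorem Tightens.of_eq {st' st : RelStore k} (hhd : st'.hd = st.hd) (hcl : st'.cl = st.cl)
    (hans : st'.s.ans = st.s.ans) : Tightens n st' st := by
  refine ⟨hhd, fun u v => by rw [hcl], fun u v a b h => by rwa [← hcl], fun u v _ => by rw [hcl],
    fun φ h => ⟨fun u hu p hp => h.pre u hu p (hhd ▸ hp), fun u hu v hv ha => h.adj u hu v hv ?_,
      fun u hu v hv => ?_⟩, hans⟩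
  · rwa [← hcl]
  · rw [hcl]
    exact h.rel u hu v hv

/-- Relations only shrink, so if nothing has changed at the end, nothing changed in between. Hence
in a run without net change all rounds of a loop see the same array. -/
theorem Tightens.cl_eq_of_cl_eq {st₁ st₂ st₃ : RelStore k} (h : Tightens n st₁ st₂)
    (h' : Tightens n st₂ st₃) (he : st₁.cl = st₃.cl) : st₂.cl = st₃.cl := by
  funext u v
  refine Prod.ext (h'.adj u v) ?_
  funext a b
  rw [Bool.eq_iff_iff]
  exact ⟨h'.rel u v a b, fun hr => h.rel u v a b (he ▸ hr)⟩

/-- Running `p` only tightens relations, and if it changes nothing then `Q` holds. -/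
def Enforces (n : ℕ) (p : RelCmd k)
    (Q : (Idx k → ℕ) → (ℕ → Option (Fin k)) → (ℕ → ℕ → Cell k) → Prop) : Prop :=
  ∀ env, (∀ i, env i < n) → ∀ st, Tightens n (p.exec n env st) st ∧
    ((p.exec n env st).cl = st.cl → Q env st.hd st.cl)

variable {p q : RelCmd k} {Q Q' : (Idx k → ℕ) → (ℕ → Option (Fin k)) → (ℕ → ℕ → Cell k) → Prop}

theorem Enforces.seq (hp : Enforces n p Q) (hq : Enforces n q Q') :
    Enforces n (.seq p q) fun env hd cl => Q env hd cl ∧ Q' env hd cl := by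
  intro env henv st
  have h1 := hp env henv st
  have h2 := hq env henv (p.exec n env st)
  refine ⟨h2.1.trans h1.1, fun he => ?_⟩
  have h3 := h2.1.cl_eq_of_cl_eq h1.1 he
  refine ⟨h1.2 h3, ?_⟩
  have := h2.2 (Eq.trans he h3.symm)
  rwa [h1.1.hd, h3] at this

theorem exec_loop_induction {i : Idx k} {env : Idx k → ℕ} {st : RelStore k}
    (P : ℕ → RelStore k → Prop) (h0 : P 0 st)
    (hs : ∀ v < n, ∀ st', P v st' → P (v + 1) (p.exec n (Function.update env i v) st')) :
    P n ((Cmd.loop i p).exec n env st) := by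
  have : ∀ m ≤ n, P m ((List.range m).foldl
      (fun st v => p.exec n (Function.update env i v) st) st) := by
    intro m
    induction m with
    | zero => exact fun _ => h0
    | succ m ih =>
      intro hm
      rw [List.range_succ, List.foldl_append]
      exact hs m hm _ (ih (by omega))
  exact this n le_rfl

theorem update_lt {i : Idx k} {env : Idx k → ℕ} (henv : ∀ i, env i < n) {v : ℕ} (hv : v < n)
    (j : Idx k) : Function.update env i v j < n := by
  by_cases h : j = i
  · subst h; simpa using hv
  · simpa [h] using henv j

theorem Enforces.loop (hp : Enforces n p Q) (i : Idx k) :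
    Enforces n (.loop i p) fun env hd cl => ∀ v < n, Q (Function.update env i v) hd cl := by
  intro env henv st
  refine exec_loop_induction (P := fun m st' => Tightens n st' st ∧
    (st'.cl = st.cl → ∀ v < m, Q (Function.update env i v) st.hd st.cl))
    ⟨.refl st, fun _ v hv => absurd hv (by omega)⟩ ?_
  rintro m hm st' ⟨h1, h2⟩
  have h3 := hp (Function.update env i m) (update_lt henv hm) st'
  refine ⟨h3.1.trans h1, fun he v hv => ?_⟩
  have h4 := h3.1.cl_eq_of_cl_eq h1 he
  rcases Nat.lt_succ_iff_lt_or_eq.1 hv with hv | rfl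
  · exact h2 h4 v hv
  · have := h3.2 (he.trans h4.symm)
    rwa [h1.hd, h4] at this

/-- Nested loops. -/
def loops (l : List (Idx k)) (p : RelCmd k) : RelCmd k := l.foldr Cmd.loop p

theorem Enforces.loops (hp : Enforces n p Q) (l : List (Idx k)) :
    Enforces n (loops l p) fun env hd cl =>
      ∀ env' : Idx k → ℕ, (∀ i, env' i < n) → (∀ i ∉ l, env' i = env i) → Q env' hd cl := by
  induction l with
  | nil =>
    intro env henv st
    refine ⟨(hp env henv st).1, fun he env' _ h => ?_⟩
    obtain rfl : env' = env := funext fun i => h i (by simp)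
    exact (hp env' henv st).2 he
  | cons i l ih =>
    intro env henv st
    have h1 := ih.loop i env henv st
    refine ⟨h1.1, fun he env' henv' h => h1.2 he (env' i) (henv' i) env' henv' fun j hj => ?_⟩
    by_cases hji : j = i
    · subst hji; simp
    · simpa [hji] using h j (by simp [hji, hj])

theorem scoped_loops (l : List (Idx k)) : ∀ T : Set (Idx k), l.Nodup → (∀ i ∈ l, i ∉ T) →
    p.Scoped (T ∪ {i | i ∈ l}) → (loops l p).Scoped T := by
  induction l with
  | nil => intro T _ _ h; simpa [loops] using h
  | cons i l ih =>
    intro T hl hT h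
    rw [List.nodup_cons] at hl
    refine ⟨hT i (by simp), ih _ hl.2 (fun j hj => ?_) ?_⟩
    · simp only [Set.mem_insert_iff, not_or]
      exact ⟨fun e => hl.1 (e ▸ hj), hT j (by simp [hj])⟩
    · convert h using 1
      ext j
      simp only [Set.mem_union, Set.mem_insert_iff, Set.mem_ofPred_eq, List.mem_cons]
      tauto

/-- Reduces the claim to the single rewritten cell: it keeps its adjacency bit, gains no pair, and
keeps the pair used by each solution. -/
theorem tightens_cell {i j : Idx k} {env : Idx k → ℕ} (henv : ∀ i, env i < n)
    (f : LocalState k → Cell k → LocalState k × Cell k) (st : RelStore k)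
    (hans : (f st.s (st.cl (env i) (env j))).1.ans = st.s.ans)
    (hadj : (f st.s (st.cl (env i) (env j))).2.1 = (st.cl (env i) (env j)).1)
    (hrel : ∀ a b, (f st.s (st.cl (env i) (env j))).2.2 a b = true →
      (st.cl (env i) (env j)).2 a b = true)
    (hsol : ∀ φ, Solves n φ st →
      (f st.s (st.cl (env i) (env j))).2.2 (φ (env i)) (φ (env j)) = true) :
    Tightens n ((Cmd.cell i j f : RelCmd k).exec n env st) st := by
  have hcl : ∀ u v, ((Cmd.cell i j f : RelCmd k).exec n env st).cl u v =
      if u = env i ∧ v = env j then (f st.s (st.cl (env i) (env j))).2 else st.cl u v := by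
    intro u v
    by_cases hu : u = env i
    · subst hu
      by_cases hv : v = env j
      · subst hv; simp [Cmd.exec]
      · simp [Cmd.exec, hv]
    · simp [Cmd.exec, hu]
  have hadj' : ∀ u v, (((Cmd.cell i j f : RelCmd k).exec n env st).cl u v).1 =
      (st.cl u v).1 := by
    intro u v
    rw [hcl]
    split_ifs with h
    · rw [hadj, h.1, h.2]
    · rfl
  refine ⟨rfl, hadj', fun u v a b h => ?_, fun u v h => ?_, fun φ hφ => ⟨hφ.pre, ?_, ?_⟩, hans⟩
  · rw [hcl] at h
    split_ifs at h with h'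
    · rw [h'.1, h'.2]; exact hrel a b h
    · exact h
  · rw [hcl, if_neg]
    rintro ⟨rfl, rfl⟩
    exact h ⟨henv i, henv j⟩
  · intro u hu v hv h
    rw [hadj'] at h
    exact hφ.adj u hu v hv h
  · intro u hu v hv
    rw [hcl]
    split_ifs with h
    · rw [h.1, h.2]; exact hsol φ hφ
    · exact hφ.rel u hu v hv

theorem exec_cell_cl (i j : Idx k) (env : Idx k → ℕ)
    (f : LocalState k → Cell k → LocalState k × Cell k) (st : RelStore k) :
    ((Cmd.cell i j f : RelCmd k).exec n env st).cl (env i) (env j) =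
      (f st.s (st.cl (env i) (env j))).2 := by
  simp [Cmd.exec]

/-- Restrict the relation of the first vertex of the tuple with itself to its allowed colours. -/
def unaryCmd (k : ℕ) : RelCmd k :=
  .seq (.head (.inl 0) fun s a => ({ s with pre := a }, a))
    (.cell (.inl 0) (.inl 0) fun s c =>
      (s, c.1, fun x y => c.2 x y && decide (x = y ∧ ∀ p, s.pre = some p → x = p)))

theorem enforces_unaryCmd : Enforces n (unaryCmd k) fun env hd cl => ∀ x y,
    (cl (env (.inl 0)) (env (.inl 0))).2 x y = true →
      x = y ∧ ∀ p, hd (env (.inl 0)) = some p → x = p := by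
  intro env henv st
  let st₁ : RelStore k := { st with s := { st.s with pre := st.hd (env (.inl 0)) } }
  -- The first command writes the head back unchanged; only the register for the precolour is new.
  have hexec : (unaryCmd k).exec n env st = (Cmd.cell (.inl 0) (.inl 0) fun s c =>
      (s, c.1, fun x y => c.2 x y && decide (x = y ∧ ∀ p, s.pre = some p → x = p)) :
        RelCmd k).exec n env st₁ := by
    simp only [unaryCmd, Cmd.exec, Function.update_eq_self, st₁]
  have h1 : Tightens n st₁ st := .of_eq rfl rfl rfl
  constructor
  · rw [hexec]
    refine (tightens_cell henv _ st₁ rfl rfl (fun a b h => ?_) fun φ hφ => ?_).trans h1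
    · exact ((Bool.and_eq_true _ _).mp h).1
    · exact (Bool.and_eq_true _ _).mpr ⟨hφ.rel _ (henv _) _ (henv _),
        decide_eq_true ⟨rfl, fun p hp => hφ.pre _ (henv _) p hp⟩⟩
  · intro he x y h
    rw [← he, hexec, exec_cell_cl] at h
    exact of_decide_eq_true ((Bool.and_eq_true _ _).mp h).2

/-- Restrict the relation of the first two vertices of the tuple if they are adjacent. -/
def binaryCmd (k : ℕ) : RelCmd k :=
  .cell (.inl 0) (.inl 1) fun s c => (s, c.1, fun x y => c.2 x y && decide (c.1 = true → x ≠ y))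

theorem enforces_binaryCmd : Enforces n (binaryCmd k) fun env _ cl => ∀ x y,
    (cl (env (.inl 0)) (env (.inl 1))).1 = true →
    (cl (env (.inl 0)) (env (.inl 1))).2 x y = true → x ≠ y := by
  intro env henv st
  constructor
  · refine tightens_cell henv _ st rfl rfl (fun a b h => ?_) fun φ hφ => ?_
    · exact ((Bool.and_eq_true _ _).mp h).1
    · exact (Bool.and_eq_true _ _).mpr ⟨hφ.rel _ (henv _) _ (henv _),
        decide_eq_true fun ha => hφ.adj _ (henv _) _ (henv _) ha⟩
  · intro he x y ha h
    rw [← he, binaryCmd, exec_cell_cl] at h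
    exact of_decide_eq_true ((Bool.and_eq_true _ _).mp h).2 ha

/-- Load the relations of the pairs of positions in the list, and then run `p`. -/
def loadThen (l : List (Fin (k + 2) × Fin (k + 2))) (p : RelCmd k) : RelCmd k :=
  l.foldr (fun x q => .seq (.cell (.inl x.1) (.inl x.2) fun s c =>
    ({ s with rel := Function.update s.rel x.1 (Function.update (s.rel x.1) x.2 c.2) }, c)) q) p

/-- The induction carries the disjunction: an entry ends up right if it is still to be loaded or is
right already, since loading a right entry again does no harm. -/
theorem exec_loadThen (env : Idx k → ℕ) (l : List (Fin (k + 2) × Fin (k + 2))) :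
    ∀ st : RelStore k, ∃ r, (∀ x y, (x, y) ∈ l ∨ st.s.rel x y =
        (st.cl (env (.inl x)) (env (.inl y))).2 → r x y =
        (st.cl (env (.inl x)) (env (.inl y))).2) ∧
      (loadThen l p).exec n env st = p.exec n env { st with s := { st.s with rel := r } } := by
  induction l with
  | nil => exact fun st => ⟨st.s.rel, by simp, rfl⟩
  | cons z l ih =>
    intro st
    obtain ⟨i, j⟩ := z
    obtain ⟨r, h1, h2⟩ := ih { st with s := { st.s with
      rel := Function.update st.s.rel i
        (Function.update (st.s.rel i) j (st.cl (env (.inl i)) (env (.inl j))).2) } }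
    refine ⟨r, fun x y h => h1 x y ?_, ?_⟩
    · by_cases hx : x = i
      · subst hx
        by_cases hy : y = j
        · subst hy; simp
        · simpa [hy] using h
      · simpa [hx] using h
    · rw [← h2]
      simp only [loadThen, List.foldr_cons, Cmd.exec, Function.update_eq_self]

theorem scoped_loadThen {T : Set (Idx k)} (hT : ∀ i, .inl i ∈ T) (hp : p.Scoped T)
    (l : List (Fin (k + 2) × Fin (k + 2))) : (loadThen l p).Scoped T := by
  induction l with
  | nil => exact hp
  | cons x l ih => exact ⟨⟨hT _, hT _⟩, ih⟩

open scoped Classical in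
/-- Keep the pairs of colours of the first two vertices that extend to the tuple. -/
noncomputable def extendCmd (k : ℕ) : RelCmd k :=
  .cell (.inl 0) (.inl 1) fun s c => (s, c.1, fun x y => c.2 x y && decide (∃ f : Fin (k + 2) → Fin k,
    f 0 = x ∧ f 1 = y ∧ IsLocalSolution s.rel f))

/-- All pairs of positions. -/
noncomputable def allPairs (k : ℕ) : List (Fin (k + 2) × Fin (k + 2)) := Finset.univ.toList

theorem enforces_extendCmd : Enforces n (loadThen (allPairs k) (extendCmd k)) fun env _ cl => ∀ x y,
    (cl (env (.inl 0)) (env (.inl 1))).2 x y = true → ∃ f : Fin (k + 2) → Fin k,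
      f 0 = x ∧ f 1 = y ∧
        IsLocalSolution (fun i j => (cl (env (.inl i)) (env (.inl j))).2) f := by
  classical
  intro env henv st
  obtain ⟨r, hr, hexec⟩ := exec_loadThen (n := n) (p := extendCmd k) env (allPairs k) st
  obtain rfl : r = fun i j => (st.cl (env (.inl i)) (env (.inl j))).2 :=
    funext fun x => funext fun y => hr x y (.inl (by simp [allPairs]))
  rw [hexec]
  have h1 : Tightens n { st with s := { st.s with rel := fun i j =>
    (st.cl (env (.inl i)) (env (.inl j))).2 } } st := .of_eq rfl rfl rfl
  constructor
  · refine (tightens_cell henv _ _ rfl rfl (fun a b h => ?_) fun φ hφ => ?_).trans h1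
    · exact ((Bool.and_eq_true _ _).mp h).1
    · exact (Bool.and_eq_true _ _).mpr ⟨hφ.rel _ (henv _) _ (henv _),
        decide_eq_true ⟨fun i => φ (env (.inl i)), rfl, rfl,
          fun i j => hφ.rel _ (henv _) _ (henv _)⟩⟩
  · intro he x y h
    rw [← he, extendCmd, exec_cell_cl] at h
    exact of_decide_eq_true ((Bool.and_eq_true _ _).mp h).2

/-- The positions of a tuple, as index variables. -/
def positions (k : ℕ) : List (Idx k) := (List.finRange (k + 2)).map .inl

/-- One pass over all tuples. -/
noncomputable def passCmd (k : ℕ) : RelCmd k :=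
  loops (positions k) (.seq (unaryCmd k) (.seq (binaryCmd k)
    (loadThen (allPairs k) (extendCmd k))))

/-- The relations are closed under all constraints on tuples. -/
structure Closed (n : ℕ) (hd : ℕ → Option (Fin k)) (cl : ℕ → ℕ → Cell k) : Prop where
  diag : ∀ u < n, ∀ x y, (cl u u).2 x y = true → x = y
  pre : ∀ u < n, ∀ x y, (cl u u).2 x y = true → ∀ p, hd u = some p → x = p
  adj : ∀ u < n, ∀ v < n, (cl u v).1 = true → ∀ x y, (cl u v).2 x y = true → x ≠ y
  cons : IsConsistent k fun u v : Fin n => (cl u v).2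

theorem enforces_passCmd : Enforces n (passCmd k) fun _ hd cl => Closed n hd cl := by
  intro env henv st
  have h := (enforces_unaryCmd (n := n) (k := k)).seq
    (enforces_binaryCmd.seq enforces_extendCmd) |>.loops (positions k) env henv st
  refine ⟨h.1, fun he => ?_⟩
  have h' : ∀ w : Fin (k + 2) → Fin n, _ := fun w => h.2 he
    (Sum.elim (fun i => (w i : ℕ)) fun b => env (.inr b))
    (by rintro (i | b); exacts [(w i).2, henv _])
    (by rintro (i | b) hi; exacts [absurd hi (by simp [positions]), rfl])
  -- Constant tuples give the conditions on one vertex, tuples starting with u, v those on an edge,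
  -- and arbitrary tuples consistency.
  refine ⟨fun u hu x y hr => ((h' fun _ => ⟨u, hu⟩).1 x y hr).1,
    fun u hu x y hr => ((h' fun _ => ⟨u, hu⟩).1 x y hr).2,
    fun u hu v hv ha x y hr => (h' fun i => if i = 0 then ⟨u, hu⟩ else ⟨v, hv⟩).2.1 x y ?_ ?_,
    fun w a b hr => (h' w).2.2 a b hr⟩
  · simpa using ha
  · simpa using hr

/-! ### Counting the passes until the relations are closed -/

/-- The number of pairs in all relations. -/
def relCount (n : ℕ) (st : RelStore k) : ℕ :=
  ((Finset.range n ×ˢ Finset.range n ×ˢ (Finset.univ : Finset (Fin k × Fin k))).filter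
    fun x => (st.cl x.1 x.2.1).2 x.2.2.1 x.2.2.2 = true).card

theorem relCount_le (st : RelStore k) : relCount n st ≤ n * (n * (k * k)) := by
  refine (Finset.card_filter_le _ _).trans ?_
  simp [Finset.card_product]

theorem Tightens.relCount_lt {st' st : RelStore k} (h : Tightens n st' st)
    (hne : st'.cl ≠ st.cl) : relCount n st' + 1 ≤ relCount n st := by
  refine Finset.card_lt_card (Finset.ssubset_iff_subset_ne.2 ⟨?_, fun he => hne ?_⟩)
  · intro x hx
    rw [Finset.mem_filter] at hx ⊢
    exact ⟨hx.1, h.rel _ _ _ _ hx.2⟩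
  · funext u v
    by_cases huv : u < n ∧ v < n
    · refine Prod.ext (h.adj u v) ?_
      funext a b
      rw [Bool.eq_iff_iff]
      refine ⟨h.rel u v a b, fun hr => ?_⟩
      have : (u, v, a, b) ∈ (Finset.range n ×ˢ Finset.range n ×ˢ
          (Finset.univ : Finset (Fin k × Fin k))).filter
          fun x => (st.cl x.1 x.2.1).2 x.2.2.1 x.2.2.2 = true := by
        simp [huv.1, huv.2, hr]
      rw [← he, Finset.mem_filter] at this
      exact this.2
    · exact h.out u v huv

/-- Running `p` reaches, on its way, a store with closed relations, or it removes at least `m`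
pairs. -/
def Progress (n m : ℕ) (p : RelCmd k) : Prop :=
  ∀ env, (∀ i, env i < n) → ∀ st, Tightens n (p.exec n env st) st ∧
    ((∃ st', Tightens n (p.exec n env st) st' ∧ Tightens n st' st ∧ Closed n st'.hd st'.cl) ∨
      relCount n (p.exec n env st) + m ≤ relCount n st)

theorem progress_passCmd : Progress n 1 (passCmd k) := by
  intro env henv st
  have h := enforces_passCmd env henv st
  refine ⟨h.1, ?_⟩
  by_cases he : ((passCmd k).exec n env st).cl = st.cl
  · exact .inl ⟨st, h.1, .refl st, h.2 he⟩
  · exact .inr (h.1.relCount_lt he)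

/-- A closed store met by either part remains an intermediate store of the whole run; if neither
part meets one, the numbers of removed pairs add up. -/
theorem Progress.seq {m m' : ℕ} (hp : Progress n m p) (hq : Progress n m' q) :
    Progress n (m + m') (.seq p q) := by
  intro env henv st
  obtain ⟨h1, h2⟩ := hp env henv st
  obtain ⟨h3, h4⟩ := hq env henv (p.exec n env st)
  refine ⟨h3.trans h1, ?_⟩
  rcases h2 with ⟨st', h5, h6, h7⟩ | h2
  · exact .inl ⟨st', h3.trans h5, h6, h7⟩
  rcases h4 with ⟨st', h5, h6, h7⟩ | h4
  · exact .inl ⟨st', h5, h6.trans h1, h7⟩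
  · refine .inr ?_
    simp only [Cmd.exec]
    omega

theorem Progress.loop {m : ℕ} (hp : Progress n m p) (i : Idx k) :
    Progress n (n * m) (.loop i p) := by
  intro env henv st
  refine exec_loop_induction (P := fun v st₁ => Tightens n st₁ st ∧
    ((∃ st', Tightens n st₁ st' ∧ Tightens n st' st ∧ Closed n st'.hd st'.cl) ∨
      relCount n st₁ + v * m ≤ relCount n st)) ⟨.refl st, .inr (by simp)⟩ ?_
  rintro v hv st₁ ⟨h1, h2⟩
  obtain ⟨h3, h4⟩ := hp (Function.update env i v) (update_lt henv hv) st₁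
  refine ⟨h3.trans h1, ?_⟩
  rcases h2 with ⟨st', h5, h6, h7⟩ | h2
  · exact .inl ⟨st', h3.trans h5, h6, h7⟩
  rcases h4 with ⟨st', h5, h6, h7⟩ | h4
  · exact .inl ⟨st', h5, h6.trans h1, h7⟩
  · refine .inr ?_
    rw [Nat.add_mul, one_mul]
    omega

/-- Run `p` another `m` times. -/
def repeatCmd (p : RelCmd k) : ℕ → RelCmd k
  | 0 => p
  | m + 1 => .seq p (repeatCmd p m)

theorem progress_repeatCmd (hp : Progress n 1 p) (m : ℕ) : Progress n (m + 1) (repeatCmd p m) := by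
  induction m with
  | zero => exact hp
  | succ m ih =>
    rw [Nat.add_comm]
    exact hp.seq ih

theorem scoped_repeatCmd {T : Set (Idx k)} (hp : p.Scoped T) (m : ℕ) :
    (repeatCmd p m).Scoped T := by
  induction m with
  | zero => exact hp
  | succ m ih => exact ⟨hp, ih⟩

/-- Make the relations consistent. -/
noncomputable def closeCmd (k : ℕ) : RelCmd k :=
  .loop (.inr false) (.loop (.inr true) (repeatCmd (passCmd k) (k * k)))

/-- There are n²(k² + 1) passes but only n²k² pairs to remove, so for n > 0 some pass changes
nothing and starts from a closed store. That store lies between the initial and the final one, which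
is all that is needed later. -/
theorem exec_closeCmd (hn : 0 < n) {env : Idx k → ℕ} (henv : ∀ i, env i < n) (st : RelStore k) :
    Tightens n ((closeCmd k).exec n env st) st ∧ ∃ st', Tightens n ((closeCmd k).exec n env st) st' ∧
      Tightens n st' st ∧ Closed n st'.hd st'.cl := by
  obtain ⟨h1, h2⟩ := ((progress_repeatCmd (progress_passCmd (k := k)) (k * k)).loop
    (.inr true)).loop (.inr false) env henv st
  refine ⟨h1, h2.resolve_right fun h => ?_⟩
  have h3 := relCount_le (n := n) st
  have h4 : n * (n * (k * k)) < n * (n * (k * k + 1)) :=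
    Nat.mul_lt_mul_of_pos_left (Nat.mul_lt_mul_of_pos_left (Nat.lt_succ_self _) hn) hn
  omega

open scoped Classical in
/-- Check that no relation is empty. -/
noncomputable def checkCmd (k : ℕ) : RelCmd k :=
  .loop (.inl 0) (.loop (.inl 1) (.cell (.inl 0) (.inl 1) fun s c =>
    ({ s with ans := s.ans && decide (∃ a b, c.2 a b = true) }, c)))

theorem exec_checkCmd (env : Idx k → ℕ) (st : RelStore k) :
    ((checkCmd k).exec n env st).s.ans = true ↔
      st.s.ans = true ∧ ∀ u < n, ∀ v < n, ∃ a b, (st.cl u v).2 a b = true := by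
  refine (exec_loop_induction (P := fun m st' => st'.cl = st.cl ∧ (st'.s.ans = true ↔
    st.s.ans = true ∧ ∀ u < m, ∀ v < n, ∃ a b, (st.cl u v).2 a b = true))
    ⟨rfl, by simp⟩ ?_).2
  rintro u hu st₁ ⟨h1, h2⟩
  refine (exec_loop_induction (P := fun m st' => st'.cl = st.cl ∧ (st'.s.ans = true ↔
    st₁.s.ans = true ∧ ∀ v < m, ∃ a b, (st.cl u v).2 a b = true))
    ⟨h1, by simp⟩ ?_).imp_right fun h => ?_
  · rintro v hv st₂ ⟨h3, h4⟩
    refine ⟨?_, ?_⟩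
    · simp [Cmd.exec, h3]
    · simp only [Cmd.exec, Bool.and_eq_true, h4, decide_eq_true_eq, h3, Nat.forall_lt_succ_right]
      simp [and_assoc]
  · rw [h, h2, Nat.forall_lt_succ_right, and_assoc]

/-- The array program for precolouring extension. -/
noncomputable def extensionCmd (k : ℕ) : RelCmd k := .seq (closeCmd k) (checkCmd k)

theorem scoped_extensionCmd : (extensionCmd k).Scoped ∅ := by
  refine ⟨⟨by simp, by simp, scoped_repeatCmd (scoped_loops _ _ ?_ ?_ ?_) _⟩, ?_⟩
  · exact (List.nodup_finRange _).map Sum.inl_injective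
  · simp [positions]
  · have hT : ∀ i : Fin (k + 2), (.inl i : Idx k) ∈ insert (Sum.inr true)
        (insert (Sum.inr false) (∅ : Set (Idx k))) ∪ {i | i ∈ positions k} := by
      simp [positions]
    exact ⟨⟨hT _, hT _, hT _⟩, ⟨hT _, hT _⟩, scoped_loadThen (p := extendCmd k) hT ⟨hT _, hT _⟩ _⟩
  · simp [checkCmd, Cmd.Scoped]

end Program

/-! ### Correctness of the program on encoded instances -/

section Correctness

variable {k : ℕ}

/-- The heads of the array for an instance. -/
def headArray (I : PrecolouringInstance k) (u : ℕ) : Option (Fin k) :=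
  if h : u < I.n then I.precolour ⟨u, h⟩ else none

open scoped Classical in
/-- The cells of the array for an instance. -/
noncomputable def cellArray (I : PrecolouringInstance k) (u v : ℕ) : Bool :=
  if h : u < I.n ∧ v < I.n then decide (I.graph.Adj ⟨u, h.1⟩ ⟨v, h.2⟩) else false

theorem encode_eq_word {σ : Type} (s : σ) (I : PrecolouringInstance k) :
    I.encode = (⟨s, I.headArray, I.cellArray⟩ : Store σ (Option (Fin k)) Bool).word I.n := by
  rw [Store.word, ← List.map_coe_finRange_eq_range, List.flatMap_map, encode]
  refine List.flatMap_congr fun u _ => ?_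
  rw [Store.row, ← List.map_coe_finRange_eq_range, encodeVertex, rowWord,
    List.map_map, List.map_map]
  refine congrArg₂ List.cons ?_ (List.map_congr_left fun w _ => ?_)
  · simp [headArray]
  · simp [cellArray]

/-- The initial state. -/
def initState (k : ℕ) : LocalState k := ⟨fun _ _ _ _ => true, none, true⟩

theorem exec_extensionCmd (hk : 0 < k) (I : PrecolouringInstance k)
    (hI : I ∈ maxDegreeAtMost k k) :
    ((extensionCmd k).exec I.n (fun _ => 0) ⟨initState k, I.headArray,
      fun u v => (I.cellArray u v, fun _ _ => true)⟩).s.ans = true ↔ I.HasExtension := by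
  -- On the empty graph no index is in range and counting passes is of no use, but the loops do
  -- nothing and the answer stays true.
  rcases Nat.eq_zero_or_pos I.n with hn | hn
  · have : IsEmpty (Fin I.n) := by rw [hn]; infer_instance
    refine iff_of_true ?_ ⟨.mk isEmptyElim (fun {v} => isEmptyElim v), fun v => isEmptyElim v⟩
    simp [extensionCmd, closeCmd, checkCmd, Cmd.exec, hn, initState]
  let st : RelStore k := ⟨initState k, I.headArray, fun u v => (I.cellArray u v, fun _ _ => true)⟩
  obtain ⟨h1, st', h2, h3, h4⟩ := exec_closeCmd (k := k) hn (env := fun _ => 0) (fun _ => hn) st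
  have hpre : ∀ u : Fin I.n, I.headArray u = I.precolour u := fun u => by simp [headArray]
  have hadj : ∀ u v : Fin I.n, I.cellArray u v = true ↔ I.graph.Adj u v := fun u v => by
    simp [cellArray]
  refine (exec_checkCmd _ _).trans ⟨fun h => ?_, fun ⟨c, hc⟩ => ⟨h1.ans, ?_⟩⟩
  · refine hasExtension_of_isConsistent hk I hI h4.cons
      (fun u v => ?_) (fun v => h4.diag v v.2) (fun u v a b ha hr => ?_)
      fun u v a b p hr hp => ?_
    -- Nonemptiness is checked at the end and passes back to the earlier closed store, whose
    -- relations are larger.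
    · obtain ⟨a, b, hab⟩ := h.2 u u.2 v v.2
      exact ⟨a, b, h2.rel _ _ _ _ hab⟩
    · refine h4.adj u u.2 v v.2 ?_ a b hr
      rw [h3.adj]
      exact (hadj u v).2 ha
    · obtain ⟨f, -, rfl, hf⟩ := h4.cons (fun i => if i = 0 then u else v) a b (by simpa using hr)
      have := hf 1 1
      simp only [one_ne_zero, if_false] at this
      refine h4.pre v v.2 _ _ this p ?_
      rw [h3.hd]
      exact (hpre v).trans hp
  -- An extension, with an arbitrary colour outside the vertex range, solves the initial
  -- constraints, which allow every pair. It is never discarded, so it witnesses that the final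
  -- relations are nonempty.
  · let φ : ℕ → Fin k := fun u => if h : u < I.n then c ⟨u, h⟩ else ⟨0, hk⟩
    have hφ : ∀ u : Fin I.n, φ u = c u := fun u => by simp [φ]
    have hsol : Solves I.n φ st := by
      refine ⟨fun u hu p hp => ?_, fun u hu v hv ha => ?_, fun _ _ _ _ => rfl⟩
      · exact (hφ ⟨u, hu⟩).trans (hc _ _ ((hpre ⟨u, hu⟩).symm.trans hp))
      · have := c.valid ((hadj ⟨u, hu⟩ ⟨v, hv⟩).1 ha)
        rwa [← hφ, ← hφ] at this
    exact fun u hu v hv => ⟨_, _, (h1.solves φ hsol).rel u hu v hv⟩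

end Correctness

end PrecolouringInstance

theorem theorem13 (k : ℕ) (hk : 0 < k) :
    PolyTimeSolvableOn (PrecolouringInstance.encode (k := k))
      (PrecolouringInstance.maxDegreeAtMost k k) PrecolouringInstance.HasExtension := by
  classical
  refine ArrayProg.polyTime_of_cmd id (fun b => (b, fun _ _ => true)) _ _ (fun I => I.1.n)
    (PrecolouringInstance.initState k) (fun I => I.1.headArray) (fun I => I.1.cellArray)
    (fun I => I.1.encode_eq_word _) (PrecolouringInstance.extensionCmd k)
    PrecolouringInstance.scoped_extensionCmd (fun s => s.ans) fun I => ?_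
  rw [Bool.eq_iff_iff, decide_eq_true_eq]
  exact PrecolouringInstance.exec_extensionCmd hk I.1 I.2
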